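/- Let $w:\mathbb C\setminus\{0\}\to \mathbb C^{N\times N}$ be analytic with $w(z)$ invertible for every $z\ne0$, and let $d\mu=w\,dm$ on the unit circle $\mathbb T$, where $dm(\zeta)=\frac{d\zeta}{2\pi i\zeta}$. Put $\hat\mu(j)=\oint_{\mathbb T}\bar\zeta^{\,j}\,d\mu(\zeta)$ and assume that $\mu$ is quasi-definite: for all $n\ge1$ the block matrices $(\hat\mu(a-b))_{a,b=0}^{n-1}$ and $(\hat\mu(b-a))_{a,b=0}^{n-1}$ are non-singular. For $n\ge0$ let $P^L_{1,n},P^R_{1,n},P^R_{2,n}$ be the (unique) monic matrix polynomials of degree $n$ with $$\oint P^L_{1,n}\,d\mu\,\bar\zeta^{\,j}=0,\qquad \oint\bar\zeta^{\,j}\,d\mu\,P^R_{1,n}=0,\qquad \oint (P^R_{2,n})^\dagger\,d\mu\,\zeta^{j}=0\qquad(0\le j<n).$$ Set $\tilde P^R_{2,n}(z)=z^n\big(P^R_{2,n}(\bar z^{-1})\big)^\dagger$, $\alpha^L_{1,n}=P^L_{1,n}(0)$, $\alpha^R_{2,n}=P^R_{2,n}(0)$, $H^R_n=\oint (P^R_{2,n})^\dagger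 d\mu\,P^R_{1,n}$, and for $|z|\neq1$ $$Q^L_{1,n}(z)=\oint\bar\zeta^{\,n}P^L_{1,n}(\zeta)\frac{d\mu(\zeta)}{1-\bar\zeta z},\qquad Q^R_{2,n}(z)=\oint\bar\zeta^{\,n+1}\tilde P^R_{2,n}(\zeta)\frac{d\mu(\zeta)}{1-\bar\zeta z}.$$ For $z\ne0$, $|z|\ne1$ let $$Z_n=\begin{pmatrix}P^L_{1,n}&Q^L_{1,n}\\-(H^R_{n-1})^{-1}\tilde P^R_{2,n-1}&-(H^R_{n-1})^{-1}Q^R_{2,n-1}\end{pmatrix}\begin{pmatrix}w(z)z^{-n}&0\\0&I_N\end{pmatrix}\ (n\ge1),\qquad Z_0=\begin{pmatrix}w&Q^L_{1,0}\\0&I_N\end{pmatrix},$$ and $M_n=Z_n'Z_n^{-1}$. Let $W(z)=w'(z)w(z)^{-1}=\sum_{j}W_jz^j$ be the Laurent series on $\mathbb C\setminus\{0\}$ of the right logarithmic derivative of $w$, and assume that one of the following holds: ordinary case: $W_j=0$ for $j<0$; put $W_n^{[0]}=-nI_N$, $p=1$; Fuchsian case: $W_{-1}\ne0$ and $W_j=0$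 for $j<-1$; put $W_n^{[0]}=W_{-1}-nI_N$, $p=1$; non-Fuchsian case: for some $r>1$, $W_{-r}\neq0$ and $W_j=0$ for $j<-r$; put $W_n^{[0]}=W_{-r}$, $p=r$. Then for every $n\ge0$ all matrices $H^R_k$ ($k\ge0$) are invertible, $Z_n$ is analytic and invertible for $z\neq0$, $|z|\ne1$, and $M_n$ extends across $\mathbb T$ to a function on $\mathbb C\setminus\{0\}$ with a convergent Laurent series there, of the form $$M_n(z)=M_n^{[0]}z^{-p}+M_{n,-p+1}z^{-p+1}+M_{n,-p+2}z^{-p+2}+\cdots .$$ For $n\ge1$ $$M_n^{[0]}=\begin{pmatrix}\alpha^L_{1,n}W_n^{[0]}(\alpha^R_{2,n})^\dagger&-\alpha^L_{1,n}W_n^{[0]}H^R_n\\-(H^R_{n-1})^{-1}W_n^{[0]}(\alpha^R_{2,n})^\dagger&(H^R_{n-1})^{-1}W_n^{[0]}H^R_n\end{pmatrix}=\begin{pmatrix}\alpha^L_{1,n}\\-(H^R_{n-1})^{-1}\end{pmatrix}W_n^{[0]}\begin{pmatrix}(\alpha^R_{2,n})^\dagger&-H^R_n\end{pmatrix},$$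 and for $n=0$ $$M_0^{[0]}=\begin{pmatrix}W_0^{[0]}&-W_0^{[0]}H^R_0\\0&0\end{pmatrix}.$$ -/

import Mathlib

open scoped ComplexConjugate Matrix

namespace MatrixSzego

/-- Complex `N × N` matrices. -/
abbrev Mat (N : ℕ) : Type := Matrix (Fin N) (Fin N) ℂ

/-! ### Entrywise calculus for matrix functions of a complex variable -/

/-- The integral `∮ F(ζ) dm(ζ)` over the unit circle, `dm(ζ) = dζ / (2 π i ζ)`, entry by entry. -/
noncomputable def circleMean {N : ℕ} (F : ℂ → Mat N) : Mat N :=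
  Matrix.of fun i j => (2 * Real.pi * Complex.I)⁻¹ * ∮ ζ in C(0, 1), ζ⁻¹ * F ζ i j

/-- The complex derivative of a matrix function, entry by entry. -/
noncomputable def matDeriv {ι : Type*} (F : ℂ → Matrix ι ι ℂ) (z : ℂ) : Matrix ι ι ℂ :=
  Matrix.of fun i j => deriv (fun u => F u i j) z

/-- The right logarithmic derivative `F'(z) F(z)⁻¹`. -/
noncomputable def rightLogDeriv {ι : Type*} [Fintype ι] [DecidableEq ι]
    (F : ℂ → Matrix ι ι ℂ) (z : ℂ) : Matrix ι ι ℂ :=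
  matDeriv F z * (F z)⁻¹

/-- `F(z) = ∑_{j ∈ ℤ} A_j z^j` for all `z ≠ 0`. -/
def HasLaurentSeries {ι : Type*} (F : ℂ → Matrix ι ι ℂ) (A : ℤ → Matrix ι ι ℂ) : Prop :=
  ∀ z : ℂ, z ≠ 0 → HasSum (fun j : ℤ => z ^ j • A j) (F z)

/-- The weight is analytic on `ℂ ∖ {0}` with invertible values
(so that the inverse is analytic there, too). -/
def IsAnalyticWeight {N : ℕ} (w : ℂ → Mat N) : Prop :=
  (∀ i j, DifferentiableOn ℂ (fun z => w z i j) {0}ᶜ) ∧ ∀ z : ℂ, z ≠ 0 → IsUnit (w z)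

/-! ### Moments and quasi-definiteness of the matrix of measures `w dm` -/

/-- The moment `∮ ζ̄ ^ j w(ζ) dm(ζ)`. -/
noncomputable def moment {N : ℕ} (w : ℂ → Mat N) (j : ℤ) : Mat N :=
  circleMean fun ζ => conj ζ ^ j • w ζ

/-- The truncated left moment matrix: the block `(a, b)` is the moment of index `a - b`. -/
noncomputable def momentMatrixL {N : ℕ} (w : ℂ → Mat N) (n : ℕ) :
    Matrix (Fin n × Fin N) (Fin n × Fin N) ℂ :=
  Matrix.of fun a b => moment w ((a.1 : ℤ) - (b.1 : ℤ)) a.2 b.2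

/-- The truncated right moment matrix: the block `(a, b)` is the moment of index `b - a`. -/
noncomputable def momentMatrixR {N : ℕ} (w : ℂ → Mat N) (n : ℕ) :
    Matrix (Fin n × Fin N) (Fin n × Fin N) ℂ :=
  Matrix.of fun a b => moment w ((b.1 : ℤ) - (a.1 : ℤ)) a.2 b.2

/-- Quasi-definiteness: no truncated moment matrix is singular. -/
def QuasiDefinite {N : ℕ} (w : ℂ → Mat N) : Prop :=
  ∀ n : ℕ, 1 ≤ n → (momentMatrixL w n).det ≠ 0 ∧ (momentMatrixR w n).det ≠ 0

/-! ### Matrix Szegő polynomials -/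

/-- The value `∑ₖ zᵏ Pₖ` of a matrix polynomial at a complex number. -/
noncomputable def evalAt {N : ℕ} (P : Polynomial (Mat N)) (z : ℂ) : Mat N :=
  P.sum fun k a => z ^ k • a

/-- `P(z) = P₀ + ⋯ + Pₙ₋₁ zⁿ⁻¹ + I zⁿ`. -/
def IsMonicOfDegree {N : ℕ} (P : Polynomial (Mat N)) (n : ℕ) : Prop :=
  P.natDegree ≤ n ∧ P.coeff n = 1

/-- `P` is a left Szegő polynomial of the first kind:
monic of degree `n` with `∮ P(ζ) dμ(ζ) ζ̄ ^ j = 0` for `0 ≤ j < n`. -/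
def IsSzegoL1 {N : ℕ} (w : ℂ → Mat N) (n : ℕ) (P : Polynomial (Mat N)) : Prop :=
  IsMonicOfDegree P n ∧
    ∀ j : ℕ, j < n → circleMean (fun ζ => conj ζ ^ j • (evalAt P ζ * w ζ)) = 0

/-- `P` is a right Szegő polynomial of the first kind:
monic of degree `n` with `∮ ζ̄ ^ j dμ(ζ) P(ζ) = 0` for `0 ≤ j < n`. -/
def IsSzegoR1 {N : ℕ} (w : ℂ → Mat N) (n : ℕ) (P : Polynomial (Mat N)) : Prop :=
  IsMonicOfDegree P n ∧
    ∀ j : ℕ, j < n → circleMean (fun ζ => conj ζ ^ j • (w ζ * evalAt P ζ)) = 0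

/-- `P` is a right Szegő polynomial of the second kind:
monic of degree `n` with `∮ P(ζ)† dμ(ζ) ζ ^ j = 0` for `0 ≤ j < n`. -/
def IsSzegoR2 {N : ℕ} (w : ℂ → Mat N) (n : ℕ) (P : Polynomial (Mat N)) : Prop :=
  IsMonicOfDegree P n ∧
    ∀ j : ℕ, j < n → circleMean (fun ζ => ζ ^ j • ((evalAt P ζ)ᴴ * w ζ)) = 0

/-- The polynomial `P^L_{1,n}`; see `existsUnique_szegoL1`. -/
noncomputable def szegoL1 {N : ℕ} (w : ℂ → Mat N) (n : ℕ) : Polynomial (Mat N) :=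
  Classical.epsilon (IsSzegoL1 w n)

/-- The polynomial `P^R_{1,n}`; see `existsUnique_szegoR1`. -/
noncomputable def szegoR1 {N : ℕ} (w : ℂ → Mat N) (n : ℕ) : Polynomial (Mat N) :=
  Classical.epsilon (IsSzegoR1 w n)

/-- The polynomial `P^R_{2,n}`; see `existsUnique_szegoR2`. -/
noncomputable def szegoR2 {N : ℕ} (w : ℂ → Mat N) (n : ℕ) : Polynomial (Mat N) :=
  Classical.epsilon (IsSzegoR2 w n)

/-- The value at `z` of the reciprocal polynomial `zⁿ P(1 / z̄)†` of a polynomial of degree at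
most `n`, that is, of `∑ₖ Pₖ† zⁿ⁻ᵏ`. -/
noncomputable def reciprocalAt {N : ℕ} (n : ℕ) (P : Polynomial (Mat N)) (z : ℂ) : Mat N :=
  ∑ k ∈ Finset.range (n + 1), z ^ (n - k) • (P.coeff k)ᴴ

/-- The Verblunsky matrix `α^L_{1,n} = P^L_{1,n}(0)`. -/
noncomputable def verblunskyL1 {N : ℕ} (w : ℂ → Mat N) (n : ℕ) : Mat N :=
  evalAt (szegoL1 w n) 0

/-- The Verblunsky matrix `α^R_{2,n} = P^R_{2,n}(0)`. -/
noncomputable def verblunskyR2 {N : ℕ} (w : ℂ → Mat N) (n : ℕ) : Mat N :=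
  evalAt (szegoR2 w n) 0

/-- The quasi-tau matrix `H^R_n = ∮ P^R_{2,n}(ζ)† dμ(ζ) P^R_{1,n}(ζ)`. -/
noncomputable def quasiTauR {N : ℕ} (w : ℂ → Mat N) (n : ℕ) : Mat N :=
  circleMean fun ζ => (evalAt (szegoR2 w n) ζ)ᴴ * w ζ * evalAt (szegoR1 w n) ζ

/-! ### Cauchy transforms and the matrices `Z_n`, `M_n` -/

/-- `Q^L_{1,n}(z) = ∮ ζ̄ⁿ P^L_{1,n}(ζ) dμ(ζ) / (1 - ζ̄ z)`. -/
noncomputable def cauchyL1 {N : ℕ} (w : ℂ → Mat N) (n : ℕ) (z : ℂ) : Mat N :=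
  circleMean fun ζ => (conj ζ ^ n / (1 - conj ζ * z)) • (evalAt (szegoL1 w n) ζ * w ζ)

/-- `Q^R_{2,n}(z) = ∮ ζ̄ⁿ⁺¹ P̃^R_{2,n}(ζ) dμ(ζ) / (1 - ζ̄ z)`. -/
noncomputable def cauchyR2 {N : ℕ} (w : ℂ → Mat N) (n : ℕ) (z : ℂ) : Mat N :=
  circleMean fun ζ =>
    (conj ζ ^ (n + 1) / (1 - conj ζ * z)) • (reciprocalAt n (szegoR2 w n) ζ * w ζ)

/-- The `2N × 2N` matrix `Z_n(z)`. -/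
noncomputable def matZ {N : ℕ} (w : ℂ → Mat N) :
    ℕ → ℂ → Matrix (Fin N ⊕ Fin N) (Fin N ⊕ Fin N) ℂ
  | 0, z => Matrix.fromBlocks (w z) (cauchyL1 w 0 z) 0 1
  | n + 1, z =>
    Matrix.fromBlocks
        (evalAt (szegoL1 w (n + 1)) z)
        (cauchyL1 w (n + 1) z)
        (-((quasiTauR w n)⁻¹ * reciprocalAt n (szegoR2 w n) z))
        (-((quasiTauR w n)⁻¹ * cauchyR2 w n z)) *
      Matrix.fromBlocks ((z ^ (n + 1))⁻¹ • w z) 0 0 1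

/-- `M_n(z) = Z_n'(z) Z_n(z)⁻¹`. -/
noncomputable def matM {N : ℕ} (w : ℂ → Mat N) (n : ℕ) (z : ℂ) :
    Matrix (Fin N ⊕ Fin N) (Fin N ⊕ Fin N) ℂ :=
  rightLogDeriv (matZ w n) z

/-! ### The type of the logarithmic derivative at the origin -/

/-- The three possible types at the origin. -/
inductive OriginType
  | ordinary
  | fuchsian
  | nonFuchsian (r : ℕ)

/-- A Laurent series with coefficients `A` is of the given type:
no negative powers; a simple pole; a pole of order `r > 1`. -/
def OriginType.Describes {N : ℕ} (A : ℤ → Mat N) : OriginType → Prop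
  | .ordinary => ∀ j : ℤ, j < 0 → A j = 0
  | .fuchsian => A (-1) ≠ 0 ∧ ∀ j : ℤ, j < -1 → A j = 0
  | .nonFuchsian r => 1 < r ∧ A (-r) ≠ 0 ∧ ∀ j : ℤ, j < -r → A j = 0

/-- The order of the leading power in the Laurent series of `M_n`: it is `z⁻¹` in the ordinary and
Fuchsian cases and `z⁻ʳ` in the non-Fuchsian case. -/
def OriginType.order : OriginType → ℕ
  | .ordinary => 1
  | .fuchsian => 1
  | .nonFuchsian r => r

/-- The matrix `W_n^{[0]}`. -/
noncomputable def OriginType.leading {N : ℕ} (A : ℤ → Mat N) (n : ℕ) : OriginType → Mat N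
  | .ordinary => -((n : ℂ) • (1 : Mat N))
  | .fuchsian => A (-1) - (n : ℂ) • (1 : Mat N)
  | .nonFuchsian r => A (-r)

/-! ### Existence and uniqueness of the Szegő polynomials -/

theorem circleMean_sum_mul {N : ℕ} {s : Finset ℕ} (a b : ℕ → Mat N) (F : ℕ → ℂ → Mat N)
    (hF : ∀ k i j, ContinuousOn (fun ζ => F k ζ i j) (Metric.sphere 0 1)) :
    circleMean (fun ζ => ∑ k ∈ s, a k * F k ζ * b k) =
      ∑ k ∈ s, a k * circleMean (F k) * b k := by
  ext i j
  have hint : ∀ k p q, CircleIntegrable (fun ζ : ℂ => ζ⁻¹ * F k ζ p q) 0 1 := by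
    intro k p q
    refine ContinuousOn.circleIntegrable zero_le_one (ContinuousOn.mul ?_ (hF k p q))
    refine continuousOn_id.inv₀ fun x hx h0 => ?_
    simp only [id] at h0
    simp [h0] at hx
  have hfun : (fun ζ : ℂ => ζ⁻¹ * (∑ k ∈ s, a k * F k ζ * b k) i j) =
      fun ζ => ∑ k ∈ s, ∑ q, ∑ p, (a k i p * b k q j) * (ζ⁻¹ * F k ζ p q) := by
    funext ζ
    simp only [Matrix.sum_apply, Matrix.mul_apply, Finset.mul_sum, Finset.sum_mul]
    refine Finset.sum_congr rfl fun k _ => Finset.sum_congr rfl fun q _ =>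
      Finset.sum_congr rfl fun p _ => by ring
  have hconst : ∀ k p q, CircleIntegrable
      (fun ζ : ℂ => (a k i p * b k q j) * (ζ⁻¹ * F k ζ p q)) 0 1 := by
    intro k p q
    exact (hint k p q).const_mul _
  have hs1 : ∀ k q, CircleIntegrable
      (fun ζ : ℂ => ∑ p, (a k i p * b k q j) * (ζ⁻¹ * F k ζ p q)) 0 1 := by
    intro k q
    exact CircleIntegrable.fun_sum _ fun p _ => hconst k p q
  have hs2 : ∀ k, CircleIntegrable
      (fun ζ : ℂ => ∑ q, ∑ p, (a k i p * b k q j) * (ζ⁻¹ * F k ζ p q)) 0 1 := by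
    intro k
    exact CircleIntegrable.fun_sum _ fun q _ => hs1 k q
  simp only [circleMean, Matrix.of_apply]
  rw [hfun, circleIntegral.integral_fun_sum fun k _ => hs2 k]
  simp only [Matrix.sum_apply, Matrix.mul_apply, Finset.mul_sum, Finset.sum_mul, Matrix.of_apply]
  refine Finset.sum_congr rfl fun k _ => ?_
  rw [circleIntegral.integral_fun_sum fun q _ => hs1 k q, Finset.mul_sum]
  refine Finset.sum_congr rfl fun q _ => ?_
  rw [circleIntegral.integral_fun_sum fun p _ => hconst k p q, Finset.mul_sum]
  refine Finset.sum_congr rfl fun p _ => ?_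
  rw [circleIntegral.integral_const_mul]
  ring

theorem evalAt_eq_sum {N : ℕ} {P : Polynomial (Mat N)} {n : ℕ} (h : P.natDegree ≤ n) (z : ℂ) :
    evalAt P z = ∑ k ∈ Finset.range (n + 1), z ^ k • P.coeff k :=
  Polynomial.sum_over_range' P (by simp) (n + 1) (Nat.lt_succ_of_le h)

theorem circleMean_congr {N : ℕ} {F G : ℂ → Mat N} (h : ∀ ζ : ℂ, ‖ζ‖ = 1 → F ζ = G ζ) :
    circleMean F = circleMean G := by
  ext i j
  simp only [circleMean, Matrix.of_apply]
  congr 1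
  refine circleIntegral.integral_congr zero_le_one fun ζ hζ => ?_
  have h1 : ‖ζ‖ = 1 := by simpa using hζ
  simp only [h ζ h1]

theorem conj_eq_inv {ζ : ℂ} (h : ‖ζ‖ = 1) : conj ζ = ζ⁻¹ := by
  rw [Complex.inv_def, Complex.normSq_eq_norm_sq, h]
  simp

theorem continuousOn_shift {N : ℕ} {w : ℂ → Mat N}
    (hw : ∀ i j, ContinuousOn (fun ζ => w ζ i j) (Metric.sphere 0 1)) (m : ℤ) (i j : Fin N) :
    ContinuousOn (fun ζ => (conj ζ ^ m • w ζ) i j) (Metric.sphere 0 1) := by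
  simp only [Matrix.smul_apply, smul_eq_mul]
  refine ContinuousOn.mul ?_ (hw i j)
  refine ContinuousOn.zpow₀ (Complex.continuous_conj.continuousOn) m fun x hx => Or.inl ?_
  intro h0
  have : x = 0 := by simpa using h0
  simp [this] at hx

theorem pairL1 {N : ℕ} {w : ℂ → Mat N}
    (hw : ∀ i j, ContinuousOn (fun ζ => w ζ i j) (Metric.sphere 0 1))
    {P : Polynomial (Mat N)} {n : ℕ} (h : P.natDegree ≤ n) (j : ℕ) :
    circleMean (fun ζ => conj ζ ^ j • (evalAt P ζ * w ζ)) =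
      ∑ k ∈ Finset.range (n + 1), P.coeff k * moment w ((j : ℤ) - k) := by
  have := circleMean_sum_mul (s := Finset.range (n + 1)) (fun k => P.coeff k) (fun _ => 1)
    (fun k ζ => conj ζ ^ ((j : ℤ) - k) • w ζ) (fun k => continuousOn_shift hw _)
  simp only [mul_one] at this
  refine Eq.trans ?_ this
  refine circleMean_congr fun ζ hζ => ?_
  have h0 : ζ ≠ 0 := by rintro rfl; simp at hζ
  rw [evalAt_eq_sum h, Finset.sum_mul, Finset.smul_sum]
  refine Finset.sum_congr rfl fun k _ => ?_
  rw [smul_mul_assoc, smul_smul, Matrix.mul_smul]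
  congr 1
  rw [conj_eq_inv hζ, zpow_sub₀ (inv_ne_zero h0), zpow_natCast, zpow_natCast]
  simp

theorem pairR1 {N : ℕ} {w : ℂ → Mat N}
    (hw : ∀ i j, ContinuousOn (fun ζ => w ζ i j) (Metric.sphere 0 1))
    {P : Polynomial (Mat N)} {n : ℕ} (h : P.natDegree ≤ n) (j : ℕ) :
    circleMean (fun ζ => conj ζ ^ j • (w ζ * evalAt P ζ)) =
      ∑ k ∈ Finset.range (n + 1), moment w ((j : ℤ) - k) * P.coeff k := by
  have := circleMean_sum_mul (s := Finset.range (n + 1)) (fun _ => 1) (fun k => P.coeff k)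
    (fun k ζ => conj ζ ^ ((j : ℤ) - k) • w ζ) (fun k => continuousOn_shift hw _)
  simp only [one_mul] at this
  refine Eq.trans ?_ this
  refine circleMean_congr fun ζ hζ => ?_
  have h0 : ζ ≠ 0 := by rintro rfl; simp at hζ
  rw [evalAt_eq_sum h, Finset.mul_sum, Finset.smul_sum]
  refine Finset.sum_congr rfl fun k _ => ?_
  rw [Matrix.mul_smul, smul_smul, smul_mul_assoc]
  congr 1
  rw [conj_eq_inv hζ, zpow_sub₀ (inv_ne_zero h0), zpow_natCast, zpow_natCast]
  simp

theorem pairR2 {N : ℕ} {w : ℂ → Mat N}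
    (hw : ∀ i j, ContinuousOn (fun ζ => w ζ i j) (Metric.sphere 0 1))
    {P : Polynomial (Mat N)} {n : ℕ} (h : P.natDegree ≤ n) (j : ℕ) :
    circleMean (fun ζ => ζ ^ j • ((evalAt P ζ)ᴴ * w ζ)) =
      ∑ k ∈ Finset.range (n + 1), (P.coeff k)ᴴ * moment w ((k : ℤ) - j) := by
  have := circleMean_sum_mul (s := Finset.range (n + 1)) (fun k => (P.coeff k)ᴴ) (fun _ => 1)
    (fun k ζ => conj ζ ^ ((k : ℤ) - j) • w ζ) (fun k => continuousOn_shift hw _)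
  simp only [mul_one] at this
  refine Eq.trans ?_ this
  refine circleMean_congr fun ζ hζ => ?_
  have h0 : ζ ≠ 0 := by rintro rfl; simp at hζ
  rw [evalAt_eq_sum h, Matrix.conjTranspose_sum, Finset.sum_mul, Finset.smul_sum]
  refine Finset.sum_congr rfl fun k _ => ?_
  rw [Matrix.conjTranspose_smul, smul_mul_assoc, smul_smul, Matrix.mul_smul]
  congr 1
  rw [star_pow, show star ζ = ζ⁻¹ from conj_eq_inv hζ, conj_eq_inv hζ,
    zpow_sub₀ (inv_ne_zero h0), zpow_natCast, zpow_natCast]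
  simp [mul_comm]

/-- The blocks of a block matrix. -/
def blocks {N n : ℕ} (T : Matrix (Fin n × Fin N) (Fin n × Fin N) ℂ) (a b : Fin n) : Mat N :=
  Matrix.of fun i j => T (a, i) (b, j)

theorem existsUnique_left {N n : ℕ} (T : Matrix (Fin n × Fin N) (Fin n × Fin N) ℂ)
    (hT : T.det ≠ 0) (b : Fin n → Mat N) :
    ∃! c : Fin n → Mat N, ∀ j, ∑ k, c k * blocks T k j = b j := by
  have hu : IsUnit T.det := isUnit_iff_ne_zero.mpr hT
  have key : ∀ c : Fin n → Mat N, (∀ j, ∑ k, c k * blocks T k j = b j) ↔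
      (Matrix.of fun i (p : Fin n × Fin N) => c p.1 i p.2) * T =
        Matrix.of fun i (p : Fin n × Fin N) => b p.1 i p.2 := by
    intro c
    constructor
    · intro h
      ext i p
      have := congrFun (congrFun (h p.1) i) p.2
      simpa [Matrix.mul_apply, Matrix.sum_apply, Fintype.sum_prod_type, blocks] using this
    · intro h j
      ext i q
      have := congrFun (congrFun h i) (j, q)
      simpa [Matrix.mul_apply, Matrix.sum_apply, Fintype.sum_prod_type, blocks] using this
  refine ⟨fun k => Matrix.of fun i q =>
    ((Matrix.of fun i (p : Fin n × Fin N) => b p.1 i p.2) * T⁻¹) i (k, q), ?_, ?_⟩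
  · refine (key _).2 ?_
    have : (Matrix.of fun i (p : Fin n × Fin N) => (Matrix.of fun i q =>
        ((Matrix.of fun i (p : Fin n × Fin N) => b p.1 i p.2) * T⁻¹) i (p.1, q) : Mat N) i p.2)
        = (Matrix.of fun i (p : Fin n × Fin N) => b p.1 i p.2) * T⁻¹ := by
      ext i p; rfl
    rw [this, Matrix.nonsing_inv_mul_cancel_right _ _ hu]
  · intro c hc
    have h := (key c).1 hc
    funext k
    ext i q
    rw [Matrix.of_apply, ← h, Matrix.mul_nonsing_inv_cancel_right _ _ hu]
    rfl

theorem existsUnique_right {N n : ℕ} (T : Matrix (Fin n × Fin N) (Fin n × Fin N) ℂ)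
    (hT : T.det ≠ 0) (b : Fin n → Mat N) :
    ∃! c : Fin n → Mat N, ∀ j, ∑ k, blocks T j k * c k = b j := by
  obtain ⟨c, hc, huniq⟩ := existsUnique_left Tᵀ (by simpa using hT) (fun j => (b j)ᵀ)
  have hb : ∀ j k, (blocks T j k)ᵀ = blocks Tᵀ k j := fun j k => by ext; rfl
  refine ⟨fun k => (c k)ᵀ, fun j => ?_, fun d hd => ?_⟩
  · have := congrArg Matrix.transpose (hc j)
    simpa [Matrix.transpose_sum, Matrix.transpose_mul, ← hb] using this
  · have := huniq (fun k => (d k)ᵀ) fun j => by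
      have := congrArg Matrix.transpose (hd j)
      simpa [Matrix.transpose_sum, Matrix.transpose_mul, hb] using this
    funext k
    simp [← this]

/-- The monic polynomial of degree `n` with given lower coefficients. -/
noncomputable def monicOf {N n : ℕ} (c : Fin n → Mat N) : Polynomial (Mat N) :=
  Polynomial.monomial n 1 + ∑ k : Fin n, Polynomial.monomial (k : ℕ) (c k)

theorem monicOf_coeff_lt {N n : ℕ} (c : Fin n → Mat N) (k : Fin n) :
    (monicOf c).coeff k = c k := by
  have h : ∀ x : Fin n, ((x : ℕ) = (k : ℕ)) ↔ x = k := fun x => Fin.ext_iff.symm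
  simp [monicOf, Polynomial.coeff_monomial, h, k.2.ne']

theorem monicOf_isMonic {N n : ℕ} (c : Fin n → Mat N) : IsMonicOfDegree (monicOf c) n := by
  refine ⟨?_, ?_⟩
  · refine (Polynomial.natDegree_add_le_of_degree_le (Polynomial.natDegree_monomial_le _) ?_)
    refine Polynomial.natDegree_sum_le_of_forall_le _ _ fun k _ => ?_
    exact (Polynomial.natDegree_monomial_le _).trans k.2.le
  · have h : ∀ x : Fin n, ((x : ℕ) = n) ↔ False := fun x => ⟨fun h => x.2.ne h, False.elim⟩
    simp [monicOf, Polynomial.coeff_monomial, h]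

theorem eq_monicOf {N n : ℕ} {P : Polynomial (Mat N)} (h : IsMonicOfDegree P n) :
    P = monicOf fun k : Fin n => P.coeff k := by
  ext1 m
  rcases lt_trichotomy m n with hm | rfl | hm
  · exact (monicOf_coeff_lt (fun k : Fin n => P.coeff k) ⟨m, hm⟩).symm
  · rw [h.2, (monicOf_isMonic _).2]
  · rw [Polynomial.coeff_eq_zero_of_natDegree_lt (h.1.trans_lt hm),
      Polynomial.coeff_eq_zero_of_natDegree_lt ((monicOf_isMonic _).1.trans_lt hm)]

/-- A monic polynomial of degree `n` is determined by conditions which determine its lower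
coefficients. -/
theorem existsUnique_monic {N n : ℕ} (C : Polynomial (Mat N) → Prop)
    (h : ∃! c : Fin n → Mat N, C (monicOf c)) :
    ∃! P : Polynomial (Mat N), IsMonicOfDegree P n ∧ C P := by
  obtain ⟨c, hc, hu⟩ := h
  refine ⟨monicOf c, ⟨monicOf_isMonic c, hc⟩, fun P hP => ?_⟩
  rw [eq_monicOf hP.1]
  congr 1
  exact hu _ (by simpa only [← eq_monicOf hP.1] using hP.2)

theorem QuasiDefinite.det_ne_zero {N : ℕ} {w : ℂ → Mat N} (hq : QuasiDefinite w) (n : ℕ) :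
    (momentMatrixL w n).det ≠ 0 ∧ (momentMatrixR w n).det ≠ 0 := by
  rcases Nat.eq_zero_or_pos n with rfl | h
  · simp
  · exact hq n h

theorem existsUnique_szegoL1 {N : ℕ} {w : ℂ → Mat N}
    (hw : ∀ i j, ContinuousOn (fun ζ => w ζ i j) (Metric.sphere 0 1))
    (hq : QuasiDefinite w) (n : ℕ) : ∃! P, IsSzegoL1 w n P := by
  refine existsUnique_monic _ ?_
  have := existsUnique_left (momentMatrixR w n) (hq.det_ne_zero n).2
    (fun j => -moment w ((j : ℤ) - n))
  refine (existsUnique_congr fun c => ?_).1 this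
  rw [Fin.forall_iff]
  refine forall_congr' fun j => forall_congr' fun hj => ?_
  rw [pairL1 hw (monicOf_isMonic c).1, Finset.sum_range_succ, (monicOf_isMonic c).2, one_mul,
    ← Fin.sum_univ_eq_sum_range (fun k => (monicOf c).coeff k * moment w ((j : ℤ) - k)),
    eq_neg_iff_add_eq_zero]
  simp only [monicOf_coeff_lt]
  rfl

theorem existsUnique_szegoR1 {N : ℕ} {w : ℂ → Mat N}
    (hw : ∀ i j, ContinuousOn (fun ζ => w ζ i j) (Metric.sphere 0 1))
    (hq : QuasiDefinite w) (n : ℕ) : ∃! P, IsSzegoR1 w n P := by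
  refine existsUnique_monic _ ?_
  have := existsUnique_right (momentMatrixL w n) (hq.det_ne_zero n).1
    (fun j => -moment w ((j : ℤ) - n))
  refine (existsUnique_congr fun c => ?_).1 this
  rw [Fin.forall_iff]
  refine forall_congr' fun j => forall_congr' fun hj => ?_
  rw [pairR1 hw (monicOf_isMonic c).1, Finset.sum_range_succ, (monicOf_isMonic c).2, mul_one,
    ← Fin.sum_univ_eq_sum_range (fun k => moment w ((j : ℤ) - k) * (monicOf c).coeff k),
    eq_neg_iff_add_eq_zero]
  simp only [monicOf_coeff_lt]
  rfl

theorem existsUnique_szegoR2 {N : ℕ} {w : ℂ → Mat N}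
    (hw : ∀ i j, ContinuousOn (fun ζ => w ζ i j) (Metric.sphere 0 1))
    (hq : QuasiDefinite w) (n : ℕ) : ∃! P, IsSzegoR2 w n P := by
  refine existsUnique_monic _ ?_
  have h0 := existsUnique_left (momentMatrixL w n) (hq.det_ne_zero n).1
    (fun j => -moment w ((n : ℤ) - j))
  have : ∃! c : Fin n → Mat N, ∀ j, ∑ k, (c k)ᴴ * blocks (momentMatrixL w n) k j =
      -moment w ((n : ℤ) - (j : Fin n)) := by
    obtain ⟨c, hc, hu⟩ := h0
    refine ⟨fun k => (c k)ᴴ, by simpa using hc, fun d hd => ?_⟩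
    rw [← hu (fun k => (d k)ᴴ) hd]
    simp
  refine (existsUnique_congr fun c => ?_).1 this
  rw [Fin.forall_iff]
  refine forall_congr' fun j => forall_congr' fun hj => ?_
  rw [pairR2 hw (monicOf_isMonic c).1, Finset.sum_range_succ, (monicOf_isMonic c).2,
    Matrix.conjTranspose_one, one_mul,
    ← Fin.sum_univ_eq_sum_range (fun k => ((monicOf c).coeff k)ᴴ * moment w ((k : ℤ) - j)),
    eq_neg_iff_add_eq_zero]
  simp only [monicOf_coeff_lt]
  rfl

end MatrixSzego

open MatrixSzego

/-! Split a function `G` analytic on the punctured plane as the entire sum `R` of the nonnegative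
Laurent terms plus the rest. Its Cauchy transform over the unit circle is `R` inside the disc and `R
- G` outside. With `G = z⁻ⁿ P w`, for `P = P^L_{1,n}` or `P = P̃^R_{2,n-1}`, this gives `Z_n = X D
J`. Here `X` (`rhMatrix`) is entire, `D = diag(z⁻ⁿ w, I)` carries the weight, and `J` is constant on
each side of the circle: the identity inside, a unipotent matrix outside (`matZ_inside`,
`matZ_outside`). A constant right factor does not affect a right logarithmic derivative, so both
sides yield `M_n = X' X⁻¹ + X diag(W - n/z, 0) X⁻¹` (`matM_eq`), which extends across the circle.

That `X⁻¹` is entire follows from the Szegő recurrences. By quasi-definiteness, a polynomial `d` of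
degree at most `n`, for which the coefficients of `d w` of index `1, …, n` vanish, equals `d(0)
P̃^R_{2,n}`, and the coefficient of index `0` is then `d(0) H^R_n`. This principle gives the
invertibility of `H^R_n`, the formula `P^L_{1,n+1} = z P^L_{1,n} + α^L_{1,n+1} P̃^R_{2,n}`, and the
formula `P̃^R_{2,n+1} = (α^R_{2,n+1})† P^L_{1,n+1} + H^R_{n+1} (H^R_n)⁻¹ P̃^R_{2,n}`. Both
recurrences pass to regular parts, so the unnormalised matrix `szegoMatrix` changes with the index
by explicit factors whose determinants multiply to a nonzero constant (`det_szegoMatrix`).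

Hence `z ^ p M_n` is entire and equals `X(0) diag(W_n^{[0]}, 0) X(0)⁻¹` at the origin. Only the
first block column of `X(0)` and the first block row of `X(0)⁻¹` enter. For `n ≥ 1` the column
consists of `α^L_{1,n}` and `-(H^R_{n-1})⁻¹`. The row is `((α^R_{2,n})†, -H^R_n)`: multiplied by
`X(0)` it gives `(1, 0)`, which is the second recurrence at the origin together with its regular
part. -/

namespace MatrixSzego

/-! ### Regular part of a function analytic on the punctured plane -/

/-- The `j`-th Laurent coefficient of a function on the punctured plane. -/
noncomputable def laurentCoeff (g : ℂ → ℂ) (j : ℕ) : ℂ :=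
  (2 * Real.pi * Complex.I)⁻¹ * ∮ ζ in C(0, 1), ζ⁻¹ * ((ζ ^ j)⁻¹ * g ζ)

/-- The sum of the terms of nonnegative degree of the Laurent series. -/
noncomputable def regularPart (g : ℂ → ℂ) (z : ℂ) : ℂ :=
  ∑' j : ℕ, z ^ j * laurentCoeff g j

theorem ne_zero_of_mem_annulus {R : ℝ} {ζ : ℂ}
    (h : ζ ∈ Metric.closedBall (0 : ℂ) R \ Metric.ball 0 1) : ζ ≠ 0 := by
  rintro rfl
  simp at h

theorem ne_zero_of_mem_sphere {R : ℝ} (hR : 0 < R) {ζ : ℂ}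
    (h : ζ ∈ Metric.sphere (0 : ℂ) R) : ζ ≠ 0 := by
  rintro rfl
  simp at h
  exact hR.ne h

/-- Cauchy's theorem on the annulus. The exceptional set `s` allows for a difference quotient
`dslope g z`, which is only known to be continuous at `z` itself. -/
theorem circleIntegral_eq_unit {f : ℂ → ℂ} {R : ℝ} (hR : 1 ≤ R) {s : Set ℂ} (hs : s.Countable)
    (hc : ContinuousOn f {0}ᶜ) (hd : ∀ z, z ≠ 0 → z ∉ s → DifferentiableAt ℂ f z) :
    (∮ ζ in C(0, R), f ζ) = ∮ ζ in C(0, 1), f ζ := by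
  refine Complex.circleIntegral_eq_of_differentiable_on_annulus_off_countable one_pos hR hs
    (hc.mono fun ζ hζ => ne_zero_of_mem_annulus hζ) fun z hz => hd z ?_ hz.2
  rintro rfl
  simpa using hz.1.2

theorem circleIntegrable_of_differentiableAt {g : ℂ → ℂ}
    (hg : ∀ z, z ≠ 0 → DifferentiableAt ℂ g z) {R : ℝ} (hR : 0 < R) : CircleIntegrable g 0 R :=
  ContinuousOn.circleIntegrable hR.le fun ζ hζ =>
    (hg ζ (ne_zero_of_mem_sphere hR hζ)).continuousAt.continuousWithinAt

/-- Expand the Cauchy kernel geometrically on the circle of radius `R`. The resulting coefficients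
can be computed on the unit circle, so they do not depend on `R`, and one power series converges in
the whole plane. -/
theorem hasSum_cauchy {g : ℂ → ℂ} (hg : ∀ z, z ≠ 0 → DifferentiableAt ℂ g z) {R : ℝ}
    (hR : 1 ≤ R) {z : ℂ} (hz : ‖z‖ < R) :
    HasSum (fun j : ℕ => z ^ j * laurentCoeff g j)
      ((2 * Real.pi * Complex.I)⁻¹ * ∮ ζ in C(0, R), (ζ - z)⁻¹ * g ζ) := by
  have h := (hasSum_two_pi_I_cauchyPowerSeries_integral
    (circleIntegrable_of_differentiableAt hg (one_pos.trans_le hR)) hz).mul_left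
      (2 * Real.pi * Complex.I)⁻¹
  simp only [zero_add, smul_eq_mul, sub_zero] at h
  have e : (fun j : ℕ => z ^ j * laurentCoeff g j) = fun j : ℕ =>
      (2 * Real.pi * Complex.I)⁻¹ * ∮ ζ in C(0, R), (z / ζ) ^ j * (ζ⁻¹ * g ζ) := by
    funext j
    have e1 : (∮ ζ in C(0, R), (z / ζ) ^ j * (ζ⁻¹ * g ζ)) =
        ∮ ζ in C(0, R), z ^ j * (ζ⁻¹ * ((ζ ^ j)⁻¹ * g ζ)) := by
      congr 1
      funext ζ
      rw [div_pow]
      ring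
    have hd : ∀ ζ : ℂ, ζ ≠ 0 → DifferentiableAt ℂ (fun ζ => ζ⁻¹ * ((ζ ^ j)⁻¹ * g ζ)) ζ :=
      fun ζ hζ => (differentiableAt_inv hζ).mul
        (((differentiableAt_id.pow j).inv (pow_ne_zero _ hζ)).mul (hg ζ hζ))
    rw [e1, circleIntegral.integral_const_mul, circleIntegral_eq_unit hR Set.countable_empty
      (fun ζ hζ => (hd ζ hζ).continuousAt.continuousWithinAt) (fun ζ hζ _ => hd ζ hζ),
      laurentCoeff]
    ring
  rw [e]
  exact h

theorem summable_regularPart {g : ℂ → ℂ} (hg : ∀ z, z ≠ 0 → DifferentiableAt ℂ g z) (z : ℂ) :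
    Summable (fun j : ℕ => z ^ j * laurentCoeff g j) :=
  (hasSum_cauchy hg (R := ‖z‖ + 1) (by linarith [norm_nonneg z]) (by linarith)).summable

theorem regularPart_eq_cauchy {g : ℂ → ℂ} (hg : ∀ z, z ≠ 0 → DifferentiableAt ℂ g z) {R : ℝ}
    (hR : 1 ≤ R) {z : ℂ} (hz : ‖z‖ < R) :
    regularPart g z = (2 * Real.pi * Complex.I)⁻¹ * ∮ ζ in C(0, R), (ζ - z)⁻¹ * g ζ :=
  (hasSum_cauchy hg hR hz).tsum_eq

/-- A power series which converges everywhere has an entire sum. -/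
theorem differentiable_tsum {a : ℕ → ℂ} (h : ∀ z : ℂ, z ≠ 0 → Summable fun j : ℕ => z ^ j * a j) :
    Differentiable ℂ fun z => ∑' j : ℕ, z ^ j * a j := by
  intro z
  have hR : (0 : ℝ) < ‖z‖ + 1 := by positivity
  -- Convergence at the real point `‖z‖ + 1` supplies the majorant for the Weierstrass test on the
  -- disc of that radius.
  have hs := (h ((‖z‖ + 1 : ℝ) : ℂ) (by exact_mod_cast hR.ne')).norm
  refine (Complex.differentiableOn_tsum_of_summable_norm (U := Metric.ball 0 (‖z‖ + 1)) hs
    (fun j => ((differentiable_pow j).mul_const (a j)).differentiableOn) Metric.isOpen_ball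
    fun j u hu => ?_).differentiableAt (Metric.isOpen_ball.mem_nhds (by simp))
  rw [norm_mul, norm_mul, norm_pow, norm_pow, Complex.norm_real, Real.norm_of_nonneg hR.le]
  have : ‖u‖ ≤ ‖z‖ + 1 := by simpa using (Metric.mem_ball.1 hu).le
  gcongr

theorem differentiable_regularPart {g : ℂ → ℂ} (hg : ∀ z, z ≠ 0 → DifferentiableAt ℂ g z) :
    Differentiable ℂ (regularPart g) :=
  differentiable_tsum fun z _ => summable_regularPart hg z

/-- The quotient `(g ζ - g z) / (ζ - z)` has the same integral over the unit circle and over a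
circle enclosing `z`. The part with `g z` contributes nothing on the former and `2πi g z` on the
latter, which accounts for the term `- g z`. -/
theorem cauchy_outside {g : ℂ → ℂ} (hg : ∀ z, z ≠ 0 → DifferentiableAt ℂ g z) {z : ℂ}
    (hz : 1 < ‖z‖) :
    (2 * Real.pi * Complex.I)⁻¹ * (∮ ζ in C(0, 1), (ζ - z)⁻¹ * g ζ) = regularPart g z - g z := by
  set R : ℝ := ‖z‖ + 1 with hRdef
  have hz0 : z ≠ 0 := by rintro rfl; simp at hz; linarith
  have hR : 1 ≤ R := by linarith
  have hzR : ‖z‖ < R := by linarith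
  have hd : ∀ u : ℂ, u ≠ 0 → u ∉ ({z} : Set ℂ) → DifferentiableAt ℂ (dslope g z) u :=
    fun u hu huz => (differentiableAt_dslope_of_ne huz).2 (hg u hu)
  have hc : ContinuousOn (dslope g z) {0}ᶜ := by
    intro u hu
    by_cases huz : u = z
    · subst huz
      exact (continuousAt_dslope_same.2 (hg u hu)).continuousWithinAt
    · exact (hd u hu huz).continuousAt.continuousWithinAt
  have key := circleIntegral_eq_unit hR (Set.countable_singleton z) hc hd
  have split : ∀ r : ℝ, 0 < r → r ≠ ‖z‖ → (∮ ζ in C(0, r), dslope g z ζ) =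
      (∮ ζ in C(0, r), (ζ - z)⁻¹ * g ζ) - (∮ ζ in C(0, r), (ζ - z)⁻¹) * g z := by
    intro r hr hrz
    have hne : ∀ ζ ∈ Metric.sphere (0 : ℂ) r, ζ - z ≠ 0 := by
      intro ζ hζ h0
      rw [sub_eq_zero] at h0
      subst h0
      simp at hζ
      exact hrz hζ.symm
    have hci : ContinuousOn (fun ζ : ℂ => (ζ - z)⁻¹) (Metric.sphere 0 r) :=
      (continuousOn_id.sub continuousOn_const).inv₀ hne
    have hcg : ContinuousOn g (Metric.sphere 0 r) := fun ζ hζ =>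
      (hg ζ (ne_zero_of_mem_sphere hr hζ)).continuousAt.continuousWithinAt
    have e2 : (∮ ζ in C(0, r), (ζ - z)⁻¹) * g z = ∮ ζ in C(0, r), (ζ - z)⁻¹ * g z := by
      rw [mul_comm, ← circleIntegral.integral_const_mul]
      simp only [mul_comm]
    have i1 : CircleIntegrable (fun ζ => (ζ - z)⁻¹ * g ζ) 0 r :=
      (hci.mul hcg).circleIntegrable hr.le
    have i2 : CircleIntegrable (fun ζ => (ζ - z)⁻¹ * g z) 0 r :=
      (hci.mul continuousOn_const).circleIntegrable hr.le
    rw [e2, ← circleIntegral.integral_sub i1 i2]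
    refine circleIntegral.integral_congr hr.le fun ζ hζ => ?_
    have : ζ ≠ z := sub_ne_zero.1 (hne ζ hζ)
    simp only [dslope_of_ne _ this, slope, vsub_eq_sub, smul_eq_mul, mul_sub]
  have h0 : (∮ ζ in C(0, 1), (ζ - z)⁻¹) = 0 := by
    refine DiffContOnCl.circleIntegral_eq_zero zero_le_one ?_
    have : DifferentiableOn ℂ (fun ζ : ℂ => (ζ - z)⁻¹) (Metric.closedBall 0 1) := by
      refine DifferentiableOn.inv (by fun_prop) fun ζ hζ h0 => ?_
      rw [sub_eq_zero] at h0
      subst h0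
      simp at hζ
      linarith
    exact DifferentiableOn.diffContOnCl (by rwa [closure_ball _ one_ne_zero])
  rw [split R (by linarith) hzR.ne', split 1 one_pos hz.ne, h0,
    circleIntegral.integral_sub_inv_of_mem_ball (by simpa using hzR), zero_mul, sub_zero] at key
  rw [regularPart_eq_cauchy hg hR hzR, ← key, mul_sub, ← mul_assoc,
    inv_mul_cancel₀ Complex.two_pi_I_ne_zero, one_mul]

/-! ### Entrywise differentiability -/

/-- All entries are differentiable at `z`. -/
def EntryDiffAt {ι κ : Type*} (F : ℂ → Matrix ι κ ℂ) (z : ℂ) : Prop :=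
  ∀ i j, DifferentiableAt ℂ (fun u => F u i j) z

section Calculus

variable {ι κ : Type*}

theorem EntryDiffAt.add {F G : ℂ → Matrix ι κ ℂ} {z : ℂ} (hF : EntryDiffAt F z)
    (hG : EntryDiffAt G z) : EntryDiffAt (fun u => F u + G u) z :=
  fun i j => (hF i j).fun_add (hG i j)

theorem EntryDiffAt.sub {F G : ℂ → Matrix ι κ ℂ} {z : ℂ} (hF : EntryDiffAt F z)
    (hG : EntryDiffAt G z) : EntryDiffAt (fun u => F u - G u) z :=
  fun i j => (hF i j).fun_sub (hG i j)

theorem EntryDiffAt.smul {f : ℂ → ℂ} {F : ℂ → Matrix ι κ ℂ} {z : ℂ}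
    (hf : DifferentiableAt ℂ f z) (hF : EntryDiffAt F z) :
    EntryDiffAt (fun u => f u • F u) z :=
  fun i j => hf.fun_mul (hF i j)

theorem entryDiffAt_const (A : Matrix ι κ ℂ) (z : ℂ) : EntryDiffAt (fun _ => A) z :=
  fun _ _ => differentiableAt_const _

theorem EntryDiffAt.mul {l : Type*} [Fintype κ] {F : ℂ → Matrix ι κ ℂ} {G : ℂ → Matrix κ l ℂ}
    {z : ℂ} (hF : EntryDiffAt F z) (hG : EntryDiffAt G z) :
    EntryDiffAt (fun u => F u * G u) z := by
  intro i j
  simp only [Matrix.mul_apply]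
  exact DifferentiableAt.fun_sum fun k _ => (hF i k).fun_mul (hG k j)

theorem EntryDiffAt.fromBlocks {a b c d : Type*} {A : ℂ → Matrix a c ℂ} {B : ℂ → Matrix a d ℂ}
    {C : ℂ → Matrix b c ℂ} {D : ℂ → Matrix b d ℂ} {z : ℂ} (hA : EntryDiffAt A z)
    (hB : EntryDiffAt B z) (hC : EntryDiffAt C z) (hD : EntryDiffAt D z) :
    EntryDiffAt (fun u => Matrix.fromBlocks (A u) (B u) (C u) (D u)) z := by
  rintro (i | i) (j | j)
  exacts [hA i j, hB i j, hC i j, hD i j]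

theorem EntryDiffAt.congr {F G : ℂ → Matrix ι κ ℂ} {z : ℂ} (hF : EntryDiffAt F z)
    (h : ∀ᶠ u in nhds z, G u = F u) : EntryDiffAt G z := fun i j =>
  (hF i j).congr_of_eventuallyEq (h.mono fun u hu => by simp only [hu])

theorem EntryDiffAt.det [Fintype ι] [DecidableEq ι] {F : ℂ → Matrix ι ι ℂ} {z : ℂ}
    (hF : EntryDiffAt F z) : DifferentiableAt ℂ (fun u => (F u).det) z := by
  simp only [Matrix.det_apply]
  exact DifferentiableAt.fun_sum fun σ _ =>
    (DifferentiableAt.fun_finsetProd fun i _ => hF (σ i) i).const_smul _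

/-- Cramer's rule: each entry is a determinant with one row replaced by constants, divided by `det
F`. -/
theorem EntryDiffAt.inv [Fintype ι] [DecidableEq ι] {F : ℂ → Matrix ι ι ℂ} {z : ℂ}
    (hF : EntryDiffAt F z) (hu : IsUnit (F z)) : EntryDiffAt (fun u => (F u)⁻¹) z := by
  have hd : (F z).det ≠ 0 := ((Matrix.isUnit_iff_isUnit_det _).1 hu).ne_zero
  intro i j
  simp only [Matrix.inv_def, Ring.inverse_eq_inv', Matrix.smul_apply, smul_eq_mul,
    Matrix.adjugate_apply]
  refine (hF.det.inv hd).fun_mul (EntryDiffAt.det fun a b => ?_)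
  by_cases ha : a = j
  · subst ha
    simp
  · simpa [Matrix.updateRow_ne ha] using hF a b

theorem matDeriv_mul [Fintype ι] {F G : ℂ → Matrix ι ι ℂ} {z : ℂ} (hF : EntryDiffAt F z)
    (hG : EntryDiffAt G z) :
    matDeriv (fun u => F u * G u) z = matDeriv F z * G z + F z * matDeriv G z := by
  ext i j
  simp only [matDeriv, Matrix.of_apply, Matrix.mul_apply, Matrix.add_apply]
  rw [deriv_fun_sum fun k _ => (hF i k).fun_mul (hG k j), ← Finset.sum_add_distrib]
  exact Finset.sum_congr rfl fun k _ => deriv_fun_mul (hF i k) (hG k j)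

theorem matDeriv_congr {F G : ℂ → Matrix ι ι ℂ} {z : ℂ} (h : ∀ᶠ u in nhds z, F u = G u) :
    matDeriv F z = matDeriv G z := by
  ext i j
  exact Filter.EventuallyEq.deriv_eq (h.mono fun u hu => by simp only [hu])

theorem matDeriv_const (A : Matrix ι ι ℂ) (z : ℂ) : matDeriv (fun _ => A) z = 0 := by
  ext i j
  simp [matDeriv]

/-- The derivative of a matrix function analytic on an open set is analytic there. -/
theorem entryDiffAt_matDeriv {F : ℂ → Matrix ι ι ℂ} {s : Set ℂ} (hs : IsOpen s)
    (hF : ∀ z ∈ s, EntryDiffAt F z) {z : ℂ} (hz : z ∈ s) : EntryDiffAt (matDeriv F) z :=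
  fun i j => ((DifferentiableOn.deriv (fun u hu => (hF u hu i j).differentiableWithinAt) hs)
    z hz).differentiableAt (hs.mem_nhds hz)

theorem rightLogDeriv_mul [Fintype ι] [DecidableEq ι] {F G : ℂ → Matrix ι ι ℂ} {z : ℂ}
    (hF : EntryDiffAt F z) (hG : EntryDiffAt G z) (hGu : IsUnit (G z)) :
    rightLogDeriv (fun u => F u * G u) z =
      matDeriv F z * (F z)⁻¹ + F z * rightLogDeriv G z * (F z)⁻¹ := by
  have h : G z * (G z)⁻¹ = 1 :=
    Matrix.mul_nonsing_inv _ ((Matrix.isUnit_iff_isUnit_det _).1 hGu)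
  rw [rightLogDeriv, matDeriv_mul hF hG, Matrix.mul_inv_rev, rightLogDeriv, Matrix.add_mul]
  congr 1
  · rw [Matrix.mul_assoc, ← Matrix.mul_assoc (G z), h, Matrix.one_mul]
  · simp only [Matrix.mul_assoc]

end Calculus

/-! ### Regular parts of matrix functions -/

section Regular

variable {N : ℕ}

theorem circleMean_const_mul (A : Mat N) {F : ℂ → Mat N} (hF : ∀ z, z ≠ 0 → EntryDiffAt F z) :
    circleMean (fun ζ => A * F ζ) = A * circleMean F := by
  have := circleMean_sum_mul (s := {0}) (fun _ => A) (fun _ => 1) (fun _ => F) fun _ i j ζ hζ =>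
    (hF ζ (ne_zero_of_mem_sphere one_pos hζ) i j).continuousAt.continuousWithinAt
  simpa using this

theorem circleMean_add {F G : ℂ → Mat N} (hF : ∀ z, z ≠ 0 → EntryDiffAt F z)
    (hG : ∀ z, z ≠ 0 → EntryDiffAt G z) :
    circleMean (fun ζ => F ζ + G ζ) = circleMean F + circleMean G := by
  -- The sum `F + G` is read as a two-term sum with unit coefficients.
  have := circleMean_sum_mul (s := Finset.range 2) (fun _ => 1) (fun _ => 1)
    (fun k => if k = 0 then F else G) fun k i j ζ hζ => by
      have h0 := ne_zero_of_mem_sphere one_pos hζ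
      split_ifs
      exacts [(hF ζ h0 i j).continuousAt.continuousWithinAt,
        (hG ζ h0 i j).continuousAt.continuousWithinAt]
  simpa [Finset.sum_range_succ] using this

/-- The matrix Laurent coefficient of index `j`. -/
noncomputable def matCoeff (G : ℂ → Mat N) (j : ℕ) : Mat N :=
  circleMean fun ζ => (ζ ^ j)⁻¹ • G ζ

/-- The terms of nonnegative degree in the Laurent series of a matrix function. -/
noncomputable def matRegular (G : ℂ → Mat N) (z : ℂ) : Mat N :=
  Matrix.of fun i j => regularPart (fun u => G u i j) z

theorem hasSum_matRegular {G : ℂ → Mat N} (hG : ∀ z, z ≠ 0 → EntryDiffAt G z) (z : ℂ) :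
    HasSum (fun k : ℕ => z ^ k • matCoeff G k) (matRegular G z) :=
  Pi.hasSum.2 fun i => Pi.hasSum.2 fun j =>
    (summable_regularPart (fun u hu => hG u hu i j) z).hasSum

theorem entryDiffAt_matRegular {G : ℂ → Mat N} (hG : ∀ z, z ≠ 0 → EntryDiffAt G z) (z : ℂ) :
    EntryDiffAt (matRegular G) z :=
  fun i j => differentiable_regularPart (fun u hu => hG u hu i j) z

theorem matRegular_zero {G : ℂ → Mat N} (hG : ∀ z, z ≠ 0 → EntryDiffAt G z) :
    matRegular G 0 = circleMean G := by
  refine (hasSum_matRegular hG 0).unique ?_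
  convert hasSum_single (0 : ℕ) (f := fun k : ℕ => (0 : ℂ) ^ k • matCoeff G k) ?_ using 1
  · simp [matCoeff]
  · intro k hk
    simp [hk]

theorem entryDiffAt_coeffFun {G : ℂ → Mat N} (hG : ∀ z, z ≠ 0 → EntryDiffAt G z) (k : ℕ) :
    ∀ z, z ≠ 0 → EntryDiffAt (fun u => (u ^ k)⁻¹ • G u) z := fun z hz =>
  EntryDiffAt.smul ((differentiableAt_pow k).fun_inv (pow_ne_zero _ hz)) (hG z hz)

theorem matRegular_const_mul (A : Mat N) {G : ℂ → Mat N} (hG : ∀ z, z ≠ 0 → EntryDiffAt G z)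
    (z : ℂ) : matRegular (fun u => A * G u) z = A * matRegular G z := by
  have hAG : ∀ z, z ≠ 0 → EntryDiffAt (fun u => A * G u) z := fun z hz =>
    (entryDiffAt_const A z).mul (hG z hz)
  refine (hasSum_matRegular hAG z).unique ?_
  have e : (fun k : ℕ => z ^ k • matCoeff (fun u => A * G u) k) =
      fun k => A * (z ^ k • matCoeff G k) := by
    funext k
    rw [Matrix.mul_smul]
    simp only [matCoeff, ← circleMean_const_mul A (entryDiffAt_coeffFun hG k), Matrix.mul_smul]
  rw [e]
  exact (hasSum_matRegular hG z).mul_left A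

theorem matRegular_add {F G : ℂ → Mat N} (hF : ∀ z, z ≠ 0 → EntryDiffAt F z)
    (hG : ∀ z, z ≠ 0 → EntryDiffAt G z) (z : ℂ) :
    matRegular (fun u => F u + G u) z = matRegular F z + matRegular G z := by
  refine (hasSum_matRegular (fun z hz => (hF z hz).add (hG z hz)) z).unique ?_
  have e : (fun k : ℕ => z ^ k • matCoeff (fun u => F u + G u) k) =
      fun k => z ^ k • matCoeff F k + z ^ k • matCoeff G k := by
    funext k
    rw [← smul_add]
    simp only [matCoeff, smul_add,
      ← circleMean_add (entryDiffAt_coeffFun hF k) (entryDiffAt_coeffFun hG k)]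
  rw [e]
  exact (hasSum_matRegular hF z).add (hasSum_matRegular hG z)

/-- The Laurent coefficients see only the unit circle, so the values at the origin are irrelevant,
even when `z = 0`. -/
theorem matRegular_congr {F G : ℂ → Mat N} (h : ∀ ζ : ℂ, ζ ≠ 0 → F ζ = G ζ) (z : ℂ) :
    matRegular F z = matRegular G z := by
  have hc : ∀ k, matCoeff F k = matCoeff G k := fun k => by
    refine circleMean_congr fun ζ hζ => ?_
    rw [h ζ (by rintro rfl; simp at hζ)]
  have hl : ∀ i j, laurentCoeff (fun u => F u i j) = laurentCoeff (fun u => G u i j) :=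
    fun i j => funext fun k => congrFun (congrFun (hc k) i) j
  ext i j
  simp only [matRegular, Matrix.of_apply, regularPart, hl]

/-- Shifting the Laurent series. -/
theorem smul_matRegular_inv_smul {G : ℂ → Mat N} (hG : ∀ z, z ≠ 0 → EntryDiffAt G z) (z : ℂ) :
    z • matRegular (fun u => u⁻¹ • G u) z = matRegular G z - circleMean G := by
  have hG' : ∀ z, z ≠ 0 → EntryDiffAt (fun u => u⁻¹ • G u) z := fun z hz =>
    EntryDiffAt.smul (differentiableAt_inv hz) (hG z hz)
  have h := (hasSum_matRegular hG' z).const_smul z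
  have e : (fun k : ℕ => z • z ^ k • matCoeff (fun u => u⁻¹ • G u) k) =
      fun k => z ^ (k + 1) • matCoeff G (k + 1) := by
    funext k
    rw [smul_smul, ← pow_succ']
    simp only [matCoeff, smul_smul, pow_succ, mul_inv]
  rw [e] at h
  rw [eq_sub_iff_add_eq, add_comm, (hasSum_matRegular hG z).tsum_eq.symm,
    (hasSum_matRegular hG z).summable.tsum_eq_zero_add, h.tsum_eq]
  simp [matCoeff]

theorem circleMean_cauchy_inside {G : ℂ → Mat N} (hG : ∀ z, z ≠ 0 → EntryDiffAt G z) {z : ℂ}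
    (hz : ‖z‖ < 1) :
    circleMean (fun ζ => (1 - ζ⁻¹ * z)⁻¹ • G ζ) = matRegular G z := by
  ext i j
  rw [matRegular, Matrix.of_apply, regularPart_eq_cauchy (fun u hu => hG u hu i j) le_rfl hz,
    circleMean, Matrix.of_apply]
  congr 1
  refine circleIntegral.integral_congr zero_le_one fun ζ hζ => ?_
  have h0 := ne_zero_of_mem_sphere one_pos hζ
  simp only [Matrix.smul_apply, smul_eq_mul]
  -- The factor `ζ⁻¹` of `dm` turns the kernel `(1 - ζ⁻¹ z)⁻¹` into `(ζ - z)⁻¹`.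
  rw [← mul_assoc, ← mul_inv, mul_sub, mul_inv_cancel_left₀ h0, mul_one]

theorem circleMean_cauchy_outside {G : ℂ → Mat N} (hG : ∀ z, z ≠ 0 → EntryDiffAt G z) {z : ℂ}
    (hz : 1 < ‖z‖) :
    circleMean (fun ζ => (1 - ζ⁻¹ * z)⁻¹ • G ζ) = matRegular G z - G z := by
  ext i j
  rw [Matrix.sub_apply, matRegular, Matrix.of_apply,
    ← cauchy_outside (fun u hu => hG u hu i j) hz, circleMean, Matrix.of_apply]
  congr 1
  refine circleIntegral.integral_congr zero_le_one fun ζ hζ => ?_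
  have h0 := ne_zero_of_mem_sphere one_pos hζ
  simp only [Matrix.smul_apply, smul_eq_mul]
  rw [← mul_assoc, ← mul_inv, mul_sub, mul_inv_cancel_left₀ h0, mul_one]

end Regular

/-! ### Szegő recurrences -/

section Szego

variable {N : ℕ}

/-- The Laurent coefficient of index `i` of `(∑ₖ zᵏ dₖ) w(z)`, the sum running over `k ≤ n`. -/
noncomputable def convCoeff (w : ℂ → Mat N) (n : ℕ) (d : ℕ → Mat N) (i : ℕ) : Mat N :=
  ∑ k ∈ Finset.range (n + 1), d k * moment w ((i : ℤ) - k)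

theorem IsAnalyticWeight.continuousOn {w : ℂ → Mat N} (hw : IsAnalyticWeight w) (i j : Fin N) :
    ContinuousOn (fun ζ => w ζ i j) (Metric.sphere 0 1) :=
  (hw.1 i j).continuousOn.mono fun _ hζ => ne_zero_of_mem_sphere one_pos hζ

theorem IsAnalyticWeight.entryDiffAt {w : ℂ → Mat N} (hw : IsAnalyticWeight w) {z : ℂ}
    (hz : z ≠ 0) : EntryDiffAt w z :=
  fun i j => (hw.1 i j).differentiableAt (isOpen_compl_singleton.mem_nhds hz)

theorem circleMean_sum_pow_mul {w : ℂ → Mat N} (hw : IsAnalyticWeight w) (n : ℕ)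
    (d : ℕ → Mat N) (i : ℕ) :
    circleMean (fun ζ => (ζ ^ i)⁻¹ • ((∑ k ∈ Finset.range (n + 1), ζ ^ k • d k) * w ζ)) =
      convCoeff w n d i := by
  have := circleMean_sum_mul (s := Finset.range (n + 1)) d (fun _ => 1)
    (fun k ζ => conj ζ ^ ((i : ℤ) - k) • w ζ) (fun k => continuousOn_shift hw.continuousOn _)
  simp only [mul_one] at this
  refine Eq.trans ?_ this
  refine circleMean_congr fun ζ hζ => ?_
  have h0 : ζ ≠ 0 := by rintro rfl; simp at hζ
  rw [Finset.sum_mul, Finset.smul_sum]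
  refine Finset.sum_congr rfl fun k _ => ?_
  rw [smul_mul_assoc, smul_smul, Matrix.mul_smul]
  congr 1
  rw [conj_eq_inv hζ, zpow_sub₀ (inv_ne_zero h0), zpow_natCast, zpow_natCast]
  simp

theorem convCoeff_sub (w : ℂ → Mat N) (n : ℕ) (d e : ℕ → Mat N) (i : ℕ) :
    convCoeff w n (fun k => d k - e k) i = convCoeff w n d i - convCoeff w n e i := by
  simp only [convCoeff, sub_mul, Finset.sum_sub_distrib]

theorem convCoeff_const_mul (w : ℂ → Mat N) (n : ℕ) (A : Mat N) (d : ℕ → Mat N) (i : ℕ) :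
    convCoeff w n (fun k => A * d k) i = A * convCoeff w n d i := by
  simp only [convCoeff, Finset.mul_sum, mul_assoc]

theorem convCoeff_succ (w : ℂ → Mat N) (n : ℕ) (d : ℕ → Mat N) (i : ℕ) :
    convCoeff w (n + 1) d i = convCoeff w n d i + d (n + 1) * moment w ((i : ℤ) - (n + 1 : ℕ)) :=
  Finset.sum_range_succ _ _

/-- Coefficients of the reciprocal polynomial of the right Szegő polynomial of the second kind. -/
noncomputable def recipCoeff (w : ℂ → Mat N) (n k : ℕ) : Mat N :=
  ((szegoR2 w n).coeff (n - k))ᴴ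

theorem reciprocalAt_eq_sum (w : ℂ → Mat N) (n : ℕ) (z : ℂ) :
    reciprocalAt n (szegoR2 w n) z = ∑ k ∈ Finset.range (n + 1), z ^ k • recipCoeff w n k := by
  rw [reciprocalAt, ← Finset.sum_range_reflect]
  refine Finset.sum_congr rfl fun k hk => ?_
  have : k ≤ n := Nat.lt_succ_iff.1 (Finset.mem_range.1 hk)
  rw [recipCoeff]
  congr 2
  omega

variable {w : ℂ → Mat N}

theorem isSzegoL1_szegoL1 (hw : IsAnalyticWeight w) (hq : QuasiDefinite w) (n : ℕ) :
    IsSzegoL1 w n (szegoL1 w n) :=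
  Classical.epsilon_spec (existsUnique_szegoL1 hw.continuousOn hq n).exists

theorem isSzegoR1_szegoR1 (hw : IsAnalyticWeight w) (hq : QuasiDefinite w) (n : ℕ) :
    IsSzegoR1 w n (szegoR1 w n) :=
  Classical.epsilon_spec (existsUnique_szegoR1 hw.continuousOn hq n).exists

theorem isSzegoR2_szegoR2 (hw : IsAnalyticWeight w) (hq : QuasiDefinite w) (n : ℕ) :
    IsSzegoR2 w n (szegoR2 w n) :=
  Classical.epsilon_spec (existsUnique_szegoR2 hw.continuousOn hq n).exists

theorem convCoeff_szegoL1 (hw : IsAnalyticWeight w) (hq : QuasiDefinite w) {n i : ℕ}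
    (hi : i < n) : convCoeff w n (szegoL1 w n).coeff i = 0 := by
  have h := isSzegoL1_szegoL1 hw hq n
  rw [← h.2 i hi, pairL1 hw.continuousOn h.1.1, convCoeff]

theorem recipCoeff_zero (hw : IsAnalyticWeight w) (hq : QuasiDefinite w) (n : ℕ) :
    recipCoeff w n 0 = 1 := by
  rw [recipCoeff, Nat.sub_zero, (isSzegoR2_szegoR2 hw hq n).1.2, Matrix.conjTranspose_one]

/-- On the circle `ζⁿ (P^R_{2,n})†` is the reciprocal polynomial. Orthogonality to `ζ ^ j` for `0 ≤
j < n` thus concerns the coefficients of index `i = n - j`, that is `1 ≤ i ≤ n`, and leaves `i = 0`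
free. -/
theorem circleMean_szegoR2 (hw : IsAnalyticWeight w) (hq : QuasiDefinite w) {n i : ℕ}
    (hi : i ≤ n) :
    circleMean (fun ζ => ζ ^ (n - i) • ((evalAt (szegoR2 w n) ζ)ᴴ * w ζ)) =
      convCoeff w n (recipCoeff w n) i := by
  rw [pairR2 hw.continuousOn (isSzegoR2_szegoR2 hw hq n).1.1, ← Finset.sum_range_reflect,
    convCoeff]
  refine Finset.sum_congr rfl fun k hk => ?_
  have : k ≤ n := Nat.lt_succ_iff.1 (Finset.mem_range.1 hk)
  rw [recipCoeff]
  congr 2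
  omega

theorem convCoeff_recipCoeff (hw : IsAnalyticWeight w) (hq : QuasiDefinite w) {n i : ℕ}
    (h1 : 1 ≤ i) (hi : i ≤ n) : convCoeff w n (recipCoeff w n) i = 0 := by
  rw [← circleMean_szegoR2 hw hq hi]
  exact (isSzegoR2_szegoR2 hw hq n).2 _ (by omega)

/-- By orthogonality of `P^R_{2,n}`, only the leading term `ζⁿ` of the monic `P^R_{1,n}` survives in
`H^R_n`. -/
theorem quasiTauR_eq_convCoeff (hw : IsAnalyticWeight w) (hq : QuasiDefinite w) (n : ℕ) :
    quasiTauR w n = convCoeff w n (recipCoeff w n) 0 := by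
  have h1 := (isSzegoR1_szegoR1 hw hq n).1
  have h2 := isSzegoR2_szegoR2 hw hq n
  have hc : ∀ k i j, ContinuousOn
      (fun ζ => (ζ ^ k • ((evalAt (szegoR2 w n) ζ)ᴴ * w ζ)) i j) (Metric.sphere 0 1) := by
    intro k i j
    simp only [Matrix.smul_apply, Matrix.mul_apply, Matrix.conjTranspose_apply,
      evalAt_eq_sum h2.1.1, Matrix.sum_apply, smul_eq_mul]
    refine (continuousOn_pow k).mul (continuousOn_finsetSum _ fun p _ => ?_)
    exact ContinuousOn.mul (Continuous.continuousOn (by fun_prop)) (hw.continuousOn p j)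
  have e := circleMean_sum_mul (s := Finset.range (n + 1)) (fun _ => 1)
    (fun k => (szegoR1 w n).coeff k)
    (fun k ζ => ζ ^ k • ((evalAt (szegoR2 w n) ζ)ᴴ * w ζ)) hc
  simp only [one_mul] at e
  rw [Finset.sum_range_succ, h1.2, mul_one, Finset.sum_eq_zero, zero_add] at e
  · rw [← circleMean_szegoR2 hw hq (Nat.zero_le n), Nat.sub_zero, ← e, quasiTauR]
    refine circleMean_congr fun ζ _ => ?_
    rw [evalAt_eq_sum h1.1, Finset.mul_sum]
    simp only [Matrix.mul_smul, smul_mul_assoc]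
  · intro k hk
    rw [h2.2 k (Finset.mem_range.1 hk), zero_mul]

/-! ### Uniqueness for the block Toeplitz system and its consequences -/

theorem blocks_momentMatrixR (w : ℂ → Mat N) (n : ℕ) (k j : Fin n) :
    blocks (momentMatrixR w n) k j = moment w (((j : ℕ) : ℤ) - (k : ℕ)) := rfl

/-- Since `d 0 = 0`, shifting both indices by one leaves `n` unknown blocks `d 1, …, d n` in the
homogeneous left system of the nonsingular `momentMatrixR w n`. -/
theorem eq_zero_of_convCoeff (hq : QuasiDefinite w) {n : ℕ} {d : ℕ → Mat N} (h0 : d 0 = 0)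
    (h : ∀ i, 1 ≤ i → i ≤ n → convCoeff w n d i = 0) {k : ℕ} (hk : k ≤ n) : d k = 0 := by
  have hd : ∀ j : Fin n, ∑ k : Fin n, d (k + 1) * blocks (momentMatrixR w n) k j = 0 := by
    intro j
    refine Eq.trans ?_ (h (j + 1) (by omega) (by omega))
    rw [convCoeff, Finset.sum_range_succ', h0, zero_mul, add_zero, ← Fin.sum_univ_eq_sum_range
      (fun k => d (k + 1) * moment w (((j + 1 : ℕ) : ℤ) - (k + 1 : ℕ)))]
    refine Finset.sum_congr rfl fun k _ => ?_
    rw [blocks_momentMatrixR, show ((j + 1 : ℕ) : ℤ) - ((k + 1 : ℕ) : ℤ) = (j : ℕ) - (k : ℕ) by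
      push_cast; ring]
  have hu := (existsUnique_left (momentMatrixR w n) (hq.det_ne_zero n).2 fun _ => 0).unique
    hd (y₂ := fun _ => 0) (by simp)
  rcases k with _ | k
  · exact h0
  · exact congrFun hu ⟨k, hk⟩

/-- The difference `d - d 0 * recipCoeff w n` satisfies the same equations and has zero constant
term, because the reciprocal of a monic polynomial has constant term `1`. -/
theorem eq_mul_recipCoeff (hw : IsAnalyticWeight w) (hq : QuasiDefinite w) {n : ℕ}
    {d : ℕ → Mat N} (h : ∀ i, 1 ≤ i → i ≤ n → convCoeff w n d i = 0) {k : ℕ} (hk : k ≤ n) :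
    d k = d 0 * recipCoeff w n k := by
  refine sub_eq_zero.1 (eq_zero_of_convCoeff hq (n := n)
    (d := fun k => d k - d 0 * recipCoeff w n k) ?_ (fun i h1 hi => ?_) hk)
  · rw [recipCoeff_zero hw hq, mul_one, sub_self]
  · rw [convCoeff_sub, convCoeff_const_mul, h i h1 hi, convCoeff_recipCoeff hw hq h1 hi,
      mul_zero, sub_zero]

theorem convCoeff_zero_eq (hw : IsAnalyticWeight w) (hq : QuasiDefinite w) {n : ℕ}
    {d : ℕ → Mat N} (h : ∀ i, 1 ≤ i → i ≤ n → convCoeff w n d i = 0) :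
    convCoeff w n d 0 = d 0 * quasiTauR w n := by
  rw [quasiTauR_eq_convCoeff hw hq, ← convCoeff_const_mul]
  exact Finset.sum_congr rfl fun k hk => by
    rw [eq_mul_recipCoeff hw hq h (Nat.lt_succ_iff.1 (Finset.mem_range.1 hk))]

/-- The system of size `n + 1` has a solution `d` whose coefficients are `1` at index `0` and `0` at
`1, …, n`. Then `d 0 * quasiTauR w n = 1`. -/
theorem isUnit_quasiTauR (hw : IsAnalyticWeight w) (hq : QuasiDefinite w) (n : ℕ) :
    IsUnit (quasiTauR w n) := by
  obtain ⟨c, hc, -⟩ := existsUnique_left (momentMatrixR w (n + 1)) (hq.det_ne_zero _).2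
    fun j => if j = 0 then 1 else 0
  let d : ℕ → Mat N := fun k => if h : k < n + 1 then c ⟨k, h⟩ else 0
  have hd : ∀ j : Fin (n + 1), convCoeff w n d j = if j = 0 then 1 else 0 := by
    intro j
    rw [← hc j, convCoeff,
      ← Fin.sum_univ_eq_sum_range (fun k => d k * moment w (((j : ℕ) : ℤ) - k))]
    refine Finset.sum_congr rfl fun k _ => ?_
    simp only [d, k.2, dif_pos]
    rfl
  have h0 := convCoeff_zero_eq hw hq (d := d) (n := n) fun i h1 hi => by
    have h := hd ⟨i, Nat.lt_succ_of_le hi⟩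
    rwa [if_neg (by simp [Fin.ext_iff]; omega)] at h
  have h1 := hd 0
  rw [if_pos rfl] at h1
  exact (Matrix.isUnit_iff_isUnit_det _).2
    (Matrix.isUnit_det_of_left_inverse (h0.symm.trans h1))

theorem verblunskyL1_eq (hw : IsAnalyticWeight w) (hq : QuasiDefinite w) (n : ℕ) :
    verblunskyL1 w n = (szegoL1 w n).coeff 0 := by
  rw [verblunskyL1, evalAt_eq_sum (isSzegoL1_szegoL1 hw hq n).1.1, Finset.sum_range_succ']
  simp

theorem verblunskyR2_eq (hw : IsAnalyticWeight w) (hq : QuasiDefinite w) (n : ℕ) :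
    verblunskyR2 w n = (szegoR2 w n).coeff 0 := by
  rw [verblunskyR2, evalAt_eq_sum (isSzegoR2_szegoR2 hw hq n).1.1, Finset.sum_range_succ']
  simp

/-- In `P^L_{1,n+1} - z P^L_{1,n}` the leading terms cancel, and the orthogonality relations of both
terms hold for the indices `1, …, n`. So `eq_mul_recipCoeff` applies, with constant term
`α^L_{1,n+1}`. -/
theorem szegoL1_succ (hw : IsAnalyticWeight w) (hq : QuasiDefinite w) (n : ℕ) (z : ℂ) :
    evalAt (szegoL1 w (n + 1)) z =
      z • evalAt (szegoL1 w n) z + verblunskyL1 w (n + 1) * reciprocalAt n (szegoR2 w n) z := by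
  have hs := isSzegoL1_szegoL1 hw hq (n + 1)
  have hs' := isSzegoL1_szegoL1 hw hq n
  -- The coefficients of `z P^L_{1,n}`.
  let s : ℕ → Mat N := fun k => Nat.casesOn k 0 fun k => (szegoL1 w n).coeff k
  have hs0 : s 0 = 0 := rfl
  have hs1 : ∀ k, s (k + 1) = (szegoL1 w n).coeff k := fun _ => rfl
  let d : ℕ → Mat N := fun k => (szegoL1 w (n + 1)).coeff k - s k
  have hd : ∀ i, 1 ≤ i → i ≤ n → convCoeff w n d i = 0 := by
    intro i h1 hi
    obtain ⟨i, rfl⟩ := Nat.exists_eq_add_of_le' h1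
    have e1 := convCoeff_succ w n (szegoL1 w (n + 1)).coeff (i + 1)
    have e2 := convCoeff_succ w n s (i + 1)
    have e3 : convCoeff w (n + 1) s (i + 1) = convCoeff w n (szegoL1 w n).coeff i := by
      rw [convCoeff, Finset.sum_range_succ', hs0, zero_mul, add_zero, convCoeff]
      refine Finset.sum_congr rfl fun k _ => ?_
      rw [hs1, show ((i + 1 : ℕ) : ℤ) - ((k + 1 : ℕ) : ℤ) = (i : ℕ) - (k : ℕ) by
        push_cast; ring]
    rw [convCoeff_szegoL1 hw hq (by omega), hs.1.2, one_mul] at e1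
    rw [e3, convCoeff_szegoL1 hw hq (by omega), show s (n + 1) = 1 from hs'.1.2, one_mul] at e2
    rw [convCoeff_sub]
    exact sub_eq_zero.2 (add_right_cancel (e1.symm.trans e2))
  have hd0 : d 0 = verblunskyL1 w (n + 1) := by
    rw [verblunskyL1_eq hw hq]
    simp [d, s]
  rw [evalAt_eq_sum hs.1.1, evalAt_eq_sum hs'.1.1, reciprocalAt_eq_sum, Finset.sum_range_succ,
    hs.1.2, Finset.mul_sum]
  have e4 : ∑ k ∈ Finset.range (n + 1), z ^ k • (szegoL1 w (n + 1)).coeff k =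
      ∑ k ∈ Finset.range (n + 1), (verblunskyL1 w (n + 1) * z ^ k • recipCoeff w n k) +
        ∑ k ∈ Finset.range (n + 1), z ^ k • s k := by
    rw [← Finset.sum_add_distrib]
    refine Finset.sum_congr rfl fun k hk => ?_
    rw [Matrix.mul_smul, ← hd0,
      ← eq_mul_recipCoeff hw hq hd (Nat.lt_succ_iff.1 (Finset.mem_range.1 hk)), ← smul_add]
    simp [d]
  have e5 : z • ∑ k ∈ Finset.range (n + 1), z ^ k • (szegoL1 w n).coeff k =
      ∑ k ∈ Finset.range (n + 1), z ^ k • s k + z ^ (n + 1) • 1 := by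
    have := Finset.sum_range_succ (fun k => z ^ k • s k) (n + 1)
    rw [show s (n + 1) = 1 from hs'.1.2] at this
    rw [← this, Finset.sum_range_succ' (fun k => z ^ k • s k), Finset.smul_sum]
    simp only [hs0, hs1, smul_zero, add_zero, smul_smul, pow_succ']
  rw [e4, e5]
  abel

/-- The leading coefficient of the reciprocal polynomial is `(α^R_{2,n+1})†`, so subtracting that
multiple of `P^L_{1,n+1}` lowers the degree to `n` and keeps the equations for `1, …, n`. The
coefficient of index `0` stays `H^R_{n+1}`, and comparison with `d 0 * H^R_n` gives the constant
term. -/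
theorem reciprocal_succ (hw : IsAnalyticWeight w) (hq : QuasiDefinite w) (n : ℕ) (z : ℂ) :
    reciprocalAt (n + 1) (szegoR2 w (n + 1)) z =
      (verblunskyR2 w (n + 1))ᴴ * evalAt (szegoL1 w (n + 1)) z +
        quasiTauR w (n + 1) * (quasiTauR w n)⁻¹ * reciprocalAt n (szegoR2 w n) z := by
  have hs := isSzegoL1_szegoL1 hw hq (n + 1)
  set β := (verblunskyR2 w (n + 1))ᴴ with hβ
  let d : ℕ → Mat N := fun k => recipCoeff w (n + 1) k - β * (szegoL1 w (n + 1)).coeff k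
  have hlast : d (n + 1) = 0 := by
    simp only [d, recipCoeff, hs.1.2, mul_one, Nat.sub_self, hβ, verblunskyR2_eq hw hq, sub_self]
  have hconv : ∀ i, convCoeff w n d i = convCoeff w (n + 1) (recipCoeff w (n + 1)) i -
      β * convCoeff w (n + 1) (szegoL1 w (n + 1)).coeff i := by
    intro i
    rw [← convCoeff_const_mul, ← convCoeff_sub, convCoeff_succ w n _ i,
      show recipCoeff w (n + 1) (n + 1) - β * (szegoL1 w (n + 1)).coeff (n + 1) = 0 from hlast,
      zero_mul, add_zero]
  have hd : ∀ i, 1 ≤ i → i ≤ n → convCoeff w n d i = 0 := by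
    intro i h1 hi
    rw [hconv, convCoeff_recipCoeff hw hq h1 (by omega), convCoeff_szegoL1 hw hq (by omega),
      mul_zero, sub_zero]
  have h0 := convCoeff_zero_eq hw hq hd
  rw [hconv, convCoeff_szegoL1 hw hq (by omega), mul_zero, sub_zero,
    ← quasiTauR_eq_convCoeff hw hq] at h0
  have hd0 : quasiTauR w (n + 1) * (quasiTauR w n)⁻¹ = d 0 := by
    rw [h0, Matrix.mul_nonsing_inv_cancel_right _ _
      ((Matrix.isUnit_iff_isUnit_det _).1 (isUnit_quasiTauR hw hq n))]
  rw [hd0, evalAt_eq_sum hs.1.1, reciprocalAt_eq_sum, reciprocalAt_eq_sum, ← sub_eq_iff_eq_add',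
    Finset.mul_sum, ← Finset.sum_sub_distrib, Finset.sum_range_succ]
  have : ∀ k, z ^ k • recipCoeff w (n + 1) k - β * z ^ k • (szegoL1 w (n + 1)).coeff k =
      z ^ k • d k := fun k => by rw [Matrix.mul_smul, ← smul_sub]
  simp only [this, hlast, smul_zero, add_zero]
  rw [Finset.mul_sum]
  refine Finset.sum_congr rfl fun k hk => ?_
  rw [Matrix.mul_smul, ← eq_mul_recipCoeff hw hq hd (Nat.lt_succ_iff.1 (Finset.mem_range.1 hk))]

end Szego

/-! ### The regularised Riemann–Hilbert matrix -/

section RiemannHilbert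

variable {N : ℕ}

theorem entryDiffAt_evalAt (P : Polynomial (Mat N)) (z : ℂ) : EntryDiffAt (evalAt P) z := by
  intro i j
  simp only [evalAt, Polynomial.sum, Matrix.sum_apply, Matrix.smul_apply, smul_eq_mul]
  exact DifferentiableAt.fun_sum fun k _ => (differentiableAt_pow k).mul_const _

theorem entryDiffAt_reciprocalAt (n : ℕ) (P : Polynomial (Mat N)) (z : ℂ) :
    EntryDiffAt (reciprocalAt n P) z := by
  intro i j
  simp only [reciprocalAt, Matrix.sum_apply, Matrix.smul_apply, smul_eq_mul]
  exact DifferentiableAt.fun_sum fun k _ => (differentiableAt_pow _).mul_const _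

/-- The regular part of `z⁻ᵐ F(z) w(z)`. -/
noncomputable def weightedRegular (w : ℂ → Mat N) (m : ℕ) (F : ℂ → Mat N) (z : ℂ) : Mat N :=
  matRegular (fun u => (u ^ m)⁻¹ • (F u * w u)) z

variable {w : ℂ → Mat N}

theorem IsAnalyticWeight.entryDiffAt_weighted (hw : IsAnalyticWeight w) (m : ℕ) {F : ℂ → Mat N}
    (hF : ∀ z, EntryDiffAt F z) (z : ℂ) (hz : z ≠ 0) :
    EntryDiffAt (fun u => (u ^ m)⁻¹ • (F u * w u)) z :=
  EntryDiffAt.smul ((differentiableAt_pow m).fun_inv (pow_ne_zero _ hz))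
    ((hF z).mul (hw.entryDiffAt hz))

theorem weightedRegular_smul (m : ℕ) (F : ℂ → Mat N) (z : ℂ) :
    weightedRegular w (m + 1) (fun u => u • F u) z = weightedRegular w m F z := by
  refine matRegular_congr (fun u hu => ?_) z
  rw [smul_mul_assoc, smul_smul, pow_succ, mul_inv, mul_assoc, inv_mul_cancel₀ hu, mul_one]

theorem weightedRegular_const_mul (hw : IsAnalyticWeight w) (m : ℕ) (A : Mat N) {F : ℂ → Mat N}
    (hF : ∀ z, EntryDiffAt F z) (z : ℂ) :
    weightedRegular w m (fun u => A * F u) z = A * weightedRegular w m F z := by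
  rw [weightedRegular, weightedRegular,
    ← matRegular_const_mul A (hw.entryDiffAt_weighted m hF)]
  exact matRegular_congr (fun u _ => by rw [Matrix.mul_smul, Matrix.mul_assoc]) z

theorem weightedRegular_add (hw : IsAnalyticWeight w) (m : ℕ) {F G : ℂ → Mat N}
    (hF : ∀ z, EntryDiffAt F z) (hG : ∀ z, EntryDiffAt G z) (z : ℂ) :
    weightedRegular w m (fun u => F u + G u) z =
      weightedRegular w m F z + weightedRegular w m G z := by
  rw [weightedRegular, weightedRegular, weightedRegular,
    ← matRegular_add (hw.entryDiffAt_weighted m hF) (hw.entryDiffAt_weighted m hG)]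
  exact matRegular_congr (fun u _ => by rw [Matrix.add_mul, smul_add]) z

theorem smul_weightedRegular_succ (hw : IsAnalyticWeight w) (m : ℕ) {F : ℂ → Mat N}
    (hF : ∀ z, EntryDiffAt F z) (z : ℂ) :
    z • weightedRegular w (m + 1) F z =
      weightedRegular w m F z - circleMean (fun ζ => (ζ ^ m)⁻¹ • (F ζ * w ζ)) := by
  rw [weightedRegular, weightedRegular,
    ← smul_matRegular_inv_smul (hw.entryDiffAt_weighted m hF)]
  congr 1
  exact matRegular_congr (fun u _ => by rw [smul_smul, pow_succ', mul_inv]) z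

theorem weightedRegular_zero (hw : IsAnalyticWeight w) (m : ℕ) {F : ℂ → Mat N}
    (hF : ∀ z, EntryDiffAt F z) :
    weightedRegular w m F 0 = circleMean (fun ζ => (ζ ^ m)⁻¹ • (F ζ * w ζ)) :=
  matRegular_zero (hw.entryDiffAt_weighted m hF)

theorem entryDiffAt_weightedRegular (hw : IsAnalyticWeight w) (m : ℕ) {F : ℂ → Mat N}
    (hF : ∀ z, EntryDiffAt F z) (z : ℂ) : EntryDiffAt (weightedRegular w m F) z :=
  entryDiffAt_matRegular (hw.entryDiffAt_weighted m hF) z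

theorem circleMean_reciprocal (hw : IsAnalyticWeight w) (n i : ℕ) :
    circleMean (fun ζ => (ζ ^ i)⁻¹ • (reciprocalAt n (szegoR2 w n) ζ * w ζ)) =
      convCoeff w n (recipCoeff w n) i := by
  rw [← circleMean_sum_pow_mul hw]
  simp only [reciprocalAt_eq_sum]

theorem cauchyL1_eq (n : ℕ) (z : ℂ) :
    cauchyL1 w n z = circleMean (fun ζ =>
      (1 - ζ⁻¹ * z)⁻¹ • ((ζ ^ n)⁻¹ • (evalAt (szegoL1 w n) ζ * w ζ))) :=
  circleMean_congr fun ζ hζ => by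
    rw [conj_eq_inv hζ, smul_smul, inv_pow, div_eq_mul_inv, mul_comm]

theorem cauchyR2_eq (n : ℕ) (z : ℂ) :
    cauchyR2 w n z = circleMean (fun ζ =>
      (1 - ζ⁻¹ * z)⁻¹ • ((ζ ^ (n + 1))⁻¹ • (reciprocalAt n (szegoR2 w n) ζ * w ζ))) :=
  circleMean_congr fun ζ hζ => by
    rw [conj_eq_inv hζ, smul_smul, inv_pow, div_eq_mul_inv, mul_comm]

theorem evalAt_szegoL1_zero (hw : IsAnalyticWeight w) (hq : QuasiDefinite w) (z : ℂ) :
    evalAt (szegoL1 w 0) z = 1 := by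
  have h := (isSzegoL1_szegoL1 hw hq 0).1
  rw [evalAt_eq_sum h.1]
  simp [h.2]

theorem reciprocalAt_szegoR2_zero (hw : IsAnalyticWeight w) (hq : QuasiDefinite w) (z : ℂ) :
    reciprocalAt 0 (szegoR2 w 0) z = 1 := by
  rw [reciprocalAt_eq_sum]
  simp [recipCoeff_zero hw hq]

/-- The entire matrix built from the Szegő polynomials and the regular parts of their products
with the weight, before normalisation of the second row. -/
noncomputable def szegoMatrix (w : ℂ → Mat N) (k : ℕ) (z : ℂ) :
    Matrix (Fin N ⊕ Fin N) (Fin N ⊕ Fin N) ℂ :=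
  Matrix.fromBlocks (evalAt (szegoL1 w (k + 1)) z)
    (weightedRegular w (k + 1) (evalAt (szegoL1 w (k + 1))) z)
    (reciprocalAt k (szegoR2 w k) z)
    (weightedRegular w (k + 1) (reciprocalAt k (szegoR2 w k)) z)

theorem weightedRegular_szegoL1_succ (hw : IsAnalyticWeight w) (hq : QuasiDefinite w)
    (n m : ℕ) (z : ℂ) :
    weightedRegular w (m + 1) (evalAt (szegoL1 w (n + 1))) z =
      weightedRegular w m (evalAt (szegoL1 w n)) z +
        verblunskyL1 w (n + 1) * weightedRegular w (m + 1) (reciprocalAt n (szegoR2 w n)) z := by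
  rw [funext (szegoL1_succ hw hq n),
    weightedRegular_add hw (m + 1)
      (fun z => EntryDiffAt.smul differentiableAt_fun_id (entryDiffAt_evalAt _ z))
      (fun z => (entryDiffAt_const _ z).mul (entryDiffAt_reciprocalAt _ _ z)),
    weightedRegular_smul, weightedRegular_const_mul hw _ _ (entryDiffAt_reciprocalAt _ _)]

theorem weightedRegular_reciprocal_succ (hw : IsAnalyticWeight w) (hq : QuasiDefinite w)
    (n m : ℕ) (z : ℂ) :
    weightedRegular w m (reciprocalAt (n + 1) (szegoR2 w (n + 1))) z =
      (verblunskyR2 w (n + 1))ᴴ * weightedRegular w m (evalAt (szegoL1 w (n + 1))) z +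
        quasiTauR w (n + 1) * (quasiTauR w n)⁻¹ *
          weightedRegular w m (reciprocalAt n (szegoR2 w n)) z := by
  rw [funext (reciprocal_succ hw hq n),
    weightedRegular_add hw m (fun z => (entryDiffAt_const _ z).mul (entryDiffAt_evalAt _ z))
      (fun z => (entryDiffAt_const _ z).mul (entryDiffAt_reciprocalAt _ _ z)),
    weightedRegular_const_mul hw _ _ (entryDiffAt_evalAt _),
    weightedRegular_const_mul hw _ _ (entryDiffAt_reciprocalAt _ _)]

/-- The term lost in the shift is the coefficient of index `n + 1` of `P̃^R_{2,n+1} w`, which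
vanishes by orthogonality. -/
theorem smul_weightedRegular_reciprocal (hw : IsAnalyticWeight w) (hq : QuasiDefinite w)
    (n : ℕ) (z : ℂ) :
    z • weightedRegular w (n + 2) (reciprocalAt (n + 1) (szegoR2 w (n + 1))) z =
      weightedRegular w (n + 1) (reciprocalAt (n + 1) (szegoR2 w (n + 1))) z := by
  rw [smul_weightedRegular_succ hw _ (entryDiffAt_reciprocalAt _ _), circleMean_reciprocal hw,
    convCoeff_recipCoeff hw hq (by omega) le_rfl, sub_zero]

/-- The inner left factor raises the index of the reciprocal polynomial and multiplies the first row
by `z`; the outer one then adds the Verblunsky term. The right factor accounts for the exponent `k +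
2` in place of `k + 1` in the regular parts. -/
theorem szegoMatrix_succ (hw : IsAnalyticWeight w) (hq : QuasiDefinite w) (k : ℕ) {z : ℂ}
    (hz : z ≠ 0) :
    szegoMatrix w (k + 1) z =
      Matrix.fromBlocks 1 (verblunskyL1 w (k + 2)) 0 1 *
        Matrix.fromBlocks (z • 1) 0 (verblunskyR2 w (k + 1))ᴴ
          (quasiTauR w (k + 1) * (quasiTauR w k)⁻¹) *
        szegoMatrix w k z * Matrix.fromBlocks 1 0 0 (z⁻¹ • 1) := by
  have h1 : weightedRegular w (k + 2) (reciprocalAt (k + 1) (szegoR2 w (k + 1))) z =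
      z⁻¹ • weightedRegular w (k + 1) (reciprocalAt (k + 1) (szegoR2 w (k + 1))) z := by
    rw [← smul_weightedRegular_reciprocal hw hq, smul_smul, inv_mul_cancel₀ hz, one_smul]
  rw [Matrix.mul_assoc (Matrix.fromBlocks 1 _ 0 1), szegoMatrix, szegoMatrix,
    Matrix.fromBlocks_multiply]
  simp only [zero_mul, add_zero, smul_mul_assoc, one_mul]
  rw [← reciprocal_succ hw hq, ← weightedRegular_reciprocal_succ hw hq,
    Matrix.fromBlocks_multiply, Matrix.fromBlocks_multiply]
  simp only [zero_mul, mul_zero, add_zero, zero_add, one_mul, mul_one, Matrix.mul_smul]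
  rw [szegoL1_succ hw hq (k + 1), weightedRegular_szegoL1_succ hw hq (k + 1) (k + 1), h1,
    smul_add, smul_smul, inv_mul_cancel₀ hz, one_smul, Matrix.mul_smul]

theorem szegoMatrix_zero (hw : IsAnalyticWeight w) (hq : QuasiDefinite w) (z : ℂ) :
    szegoMatrix w 0 z =
      Matrix.fromBlocks 1 (verblunskyL1 w 1) 0 1 * (Matrix.fromBlocks 1 (z • 1) 0 1 *
        (Matrix.fromBlocks (quasiTauR w 0) 0
          (weightedRegular w 1 (reciprocalAt 0 (szegoR2 w 0)) z) 1 *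
          Matrix.fromBlocks 0 1 1 0)) := by
  have e : evalAt (szegoL1 w 0) = reciprocalAt 0 (szegoR2 w 0) := by
    funext u
    rw [evalAt_szegoL1_zero hw hq, reciprocalAt_szegoR2_zero hw hq]
  have h := smul_weightedRegular_succ hw 0 (entryDiffAt_reciprocalAt 0 (szegoR2 w 0)) z
  rw [circleMean_reciprocal hw, ← quasiTauR_eq_convCoeff hw hq] at h
  simp only [Matrix.fromBlocks_multiply, zero_mul, mul_zero, add_zero, zero_add, one_mul, mul_one,
    smul_mul_assoc]
  rw [szegoMatrix, szegoL1_succ hw hq, weightedRegular_szegoL1_succ hw hq 0 0, e, h,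
    reciprocalAt_szegoR2_zero hw hq, mul_one, add_sub_cancel]

/-- Each recurrence step contributes `z ^ N` from the left and `z ^ (-N)` from the right, leaving
only the constant `det (H^R_{k+1} (H^R_k)⁻¹)`. -/
theorem det_szegoMatrix (hw : IsAnalyticWeight w) (hq : QuasiDefinite w) (k : ℕ) :
    ∃ c : ℂ, c ≠ 0 ∧ ∀ z, z ≠ 0 → (szegoMatrix w k z).det = c := by
  have hH : ∀ k, (quasiTauR w k).det ≠ 0 := fun k =>
    ((Matrix.isUnit_iff_isUnit_det _).1 (isUnit_quasiTauR hw hq k)).ne_zero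
  induction k with
  | zero =>
    refine ⟨(quasiTauR w 0).det *
      (Matrix.fromBlocks 0 1 1 0 : Matrix (Fin N ⊕ Fin N) (Fin N ⊕ Fin N) ℂ).det,
      mul_ne_zero (hH 0) ?_, fun z _ => ?_⟩
    · refine Matrix.det_ne_zero_of_left_inverse (B := Matrix.fromBlocks 0 1 1 0) ?_
      simp [Matrix.fromBlocks_multiply, Matrix.fromBlocks_one]
    · rw [szegoMatrix_zero hw hq]
      simp only [Matrix.det_mul, Matrix.det_fromBlocks_zero₂₁, Matrix.det_fromBlocks_zero₁₂,
        Matrix.det_one, mul_one, one_mul]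
  | succ k ih =>
    obtain ⟨c, hc, h⟩ := ih
    refine ⟨(quasiTauR w (k + 1) * (quasiTauR w k)⁻¹).det * c, mul_ne_zero ?_ hc,
      fun z hz => ?_⟩
    · rw [Matrix.det_mul]
      exact mul_ne_zero (hH _) (by simpa [Matrix.det_nonsing_inv] using hH k)
    · rw [szegoMatrix_succ hw hq k hz]
      simp only [Matrix.det_mul (Matrix.fromBlocks _ _ _ _), Matrix.det_mul (_ * szegoMatrix w k z),
        Matrix.det_mul (_ * Matrix.fromBlocks _ _ _ _), Matrix.det_fromBlocks_zero₂₁,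
        Matrix.det_fromBlocks_zero₁₂, Matrix.det_one, mul_one, one_mul, h z hz, Matrix.det_smul]
      have : z ^ Fintype.card (Fin N) * z⁻¹ ^ Fintype.card (Fin N) = 1 := by
        rw [← mul_pow, mul_inv_cancel₀ hz, one_pow]
      linear_combination ((quasiTauR w (k + 1) * (quasiTauR w k)⁻¹).det * c) * this

theorem entryDiffAt_szegoMatrix (hw : IsAnalyticWeight w) (k : ℕ) (z : ℂ) :
    EntryDiffAt (szegoMatrix w k) z :=
  EntryDiffAt.fromBlocks (entryDiffAt_evalAt _ z)
    (entryDiffAt_weightedRegular hw _ (entryDiffAt_evalAt _) z) (entryDiffAt_reciprocalAt _ _ z)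
    (entryDiffAt_weightedRegular hw _ (entryDiffAt_reciprocalAt _ _) z)

theorem isUnit_szegoMatrix (hw : IsAnalyticWeight w) (hq : QuasiDefinite w) (k : ℕ) (z : ℂ) :
    IsUnit (szegoMatrix w k z) := by
  obtain ⟨c, hc, h⟩ := det_szegoMatrix hw hq k
  have hcont : Continuous fun z => (szegoMatrix w k z).det := continuous_iff_continuousAt.2
    fun z => (entryDiffAt_szegoMatrix hw k z).det.continuousAt
  -- The recurrence step degenerates at the origin; the value of the determinant there follows by
  -- continuity.
  have := congrFun (hcont.ext_on (dense_compl_singleton (0 : ℂ)) continuous_const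
    fun z hz => h z hz) z
  rw [Matrix.isUnit_iff_isUnit_det, isUnit_iff_ne_zero]
  exact this.trans_ne hc

/-- The analytic factor of `Z_n` at the origin. -/
noncomputable def rhMatrix (w : ℂ → Mat N) : ℕ → ℂ → Matrix (Fin N ⊕ Fin N) (Fin N ⊕ Fin N) ℂ
  | 0, z => Matrix.fromBlocks 1 (weightedRegular w 0 (evalAt (szegoL1 w 0)) z) 0 1
  | n + 1, z => Matrix.fromBlocks 1 0 0 (-(quasiTauR w n)⁻¹) * szegoMatrix w n z

/-- The factor of `Z_n` which carries the weight. -/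
noncomputable def weightMatrix (w : ℂ → Mat N) (n : ℕ) (z : ℂ) :
    Matrix (Fin N ⊕ Fin N) (Fin N ⊕ Fin N) ℂ :=
  Matrix.fromBlocks ((z ^ n)⁻¹ • w z) 0 0 1

theorem entryDiffAt_rhMatrix (hw : IsAnalyticWeight w) (n : ℕ) (z : ℂ) :
    EntryDiffAt (rhMatrix w n) z := by
  cases n with
  | zero =>
    exact EntryDiffAt.fromBlocks (entryDiffAt_const _ z)
      (entryDiffAt_weightedRegular hw _ (entryDiffAt_evalAt _) z) (entryDiffAt_const _ z)
      (entryDiffAt_const _ z)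
  | succ n => exact (entryDiffAt_const _ z).mul (entryDiffAt_szegoMatrix hw n z)

theorem isUnit_rhMatrix (hw : IsAnalyticWeight w) (hq : QuasiDefinite w) (n : ℕ) (z : ℂ) :
    IsUnit (rhMatrix w n z) := by
  cases n with
  | zero => simp [rhMatrix, Matrix.isUnit_iff_isUnit_det]
  | succ n =>
    refine IsUnit.mul ?_ (isUnit_szegoMatrix hw hq n z)
    have h := isUnit_quasiTauR hw hq n
    rw [Matrix.isUnit_iff_isUnit_det, Matrix.det_fromBlocks_zero₂₁, Matrix.det_one, one_mul,
      ← Matrix.isUnit_iff_isUnit_det, IsUnit.neg_iff, Matrix.isUnit_nonsing_inv_iff]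
    exact h

theorem entryDiffAt_weightMatrix (hw : IsAnalyticWeight w) (n : ℕ) {z : ℂ} (hz : z ≠ 0) :
    EntryDiffAt (weightMatrix w n) z :=
  EntryDiffAt.fromBlocks
    (EntryDiffAt.smul ((differentiableAt_pow n).fun_inv (pow_ne_zero _ hz)) (hw.entryDiffAt hz))
    (entryDiffAt_const _ z) (entryDiffAt_const _ z) (entryDiffAt_const _ z)

theorem isUnit_weightMatrix (hw : IsAnalyticWeight w) (n : ℕ) {z : ℂ} (hz : z ≠ 0) :
    IsUnit (weightMatrix w n z) := by
  have h := (Matrix.isUnit_iff_isUnit_det _).1 (hw.2 z hz)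
  rw [Matrix.isUnit_iff_isUnit_det, weightMatrix, Matrix.det_fromBlocks_zero₂₁, Matrix.det_one,
    mul_one, Matrix.det_smul]
  exact ((isUnit_iff_ne_zero.2 (inv_ne_zero (pow_ne_zero n hz))).pow _).mul h

theorem matZ_inside (hw : IsAnalyticWeight w) (n : ℕ) {z : ℂ} (hz : ‖z‖ < 1) :
    matZ w n z = rhMatrix w n z * weightMatrix w n z := by
  have hL : ∀ n, cauchyL1 w n z = weightedRegular w n (evalAt (szegoL1 w n)) z := fun n => by
    rw [cauchyL1_eq, circleMean_cauchy_inside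
      (hw.entryDiffAt_weighted n (entryDiffAt_evalAt _)) hz, weightedRegular]
  have hR : ∀ n, cauchyR2 w n z =
      weightedRegular w (n + 1) (reciprocalAt n (szegoR2 w n)) z := fun n => by
    rw [cauchyR2_eq, circleMean_cauchy_inside
      (hw.entryDiffAt_weighted (n + 1) (entryDiffAt_reciprocalAt _ _)) hz, weightedRegular]
  cases n with
  | zero => simp [matZ, rhMatrix, weightMatrix, Matrix.fromBlocks_multiply, hL]
  | succ n =>
    simp [matZ, rhMatrix, weightMatrix, szegoMatrix, Matrix.fromBlocks_multiply, hL, hR]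

theorem matZ_outside (hw : IsAnalyticWeight w) (hq : QuasiDefinite w) (n : ℕ) {z : ℂ}
    (hz : 1 < ‖z‖) :
    matZ w n z = rhMatrix w n z * (weightMatrix w n z * Matrix.fromBlocks 1 (-1) 0 1) := by
  have hL : ∀ n, cauchyL1 w n z = weightedRegular w n (evalAt (szegoL1 w n)) z -
      (z ^ n)⁻¹ • (evalAt (szegoL1 w n) z * w z) := fun n => by
    rw [cauchyL1_eq, circleMean_cauchy_outside
      (hw.entryDiffAt_weighted n (entryDiffAt_evalAt _)) hz, weightedRegular]
  have hR : ∀ n, cauchyR2 w n z =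
      weightedRegular w (n + 1) (reciprocalAt n (szegoR2 w n)) z -
        (z ^ (n + 1))⁻¹ • (reciprocalAt n (szegoR2 w n) z * w z) := fun n => by
    rw [cauchyR2_eq, circleMean_cauchy_outside
      (hw.entryDiffAt_weighted (n + 1) (entryDiffAt_reciprocalAt _ _)) hz, weightedRegular]
  cases n with
  | zero =>
    simp [matZ, rhMatrix, weightMatrix, Matrix.fromBlocks_multiply, hL,
      evalAt_szegoL1_zero hw hq, sub_eq_neg_add]
  | succ n =>
    simp [matZ, rhMatrix, weightMatrix, szegoMatrix, Matrix.fromBlocks_multiply, hL, hR,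
      sub_eq_neg_add, mul_add, Matrix.mul_assoc]
    exact add_comm _ _

end RiemannHilbert

/-! ### The logarithmic derivative of `Z_n` -/

section LogDeriv

variable {N : ℕ} {w : ℂ → Mat N}

/-- This removes the jump across the circle: the sides differ by a constant right factor. -/
theorem rightLogDeriv_mul_const {ι : Type*} [Fintype ι] [DecidableEq ι]
    {F : ℂ → Matrix ι ι ℂ} {z : ℂ} (hF : EntryDiffAt F z) {J : Matrix ι ι ℂ} (hJ : IsUnit J) :
    rightLogDeriv (fun u => F u * J) z = rightLogDeriv F z := by
  rw [rightLogDeriv_mul hF (entryDiffAt_const J z) hJ]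
  simp only [rightLogDeriv, matDeriv_const, zero_mul, mul_zero, add_zero]

theorem rightLogDeriv_congr {ι : Type*} [Fintype ι] [DecidableEq ι]
    {F G : ℂ → Matrix ι ι ℂ} {z : ℂ} (h : ∀ᶠ u in nhds z, F u = G u) :
    rightLogDeriv F z = rightLogDeriv G z := by
  rw [rightLogDeriv, rightLogDeriv, matDeriv_congr h, h.self_of_nhds]

theorem matDeriv_inv_pow_smul (hw : IsAnalyticWeight w) (n : ℕ) {z : ℂ} (hz : z ≠ 0) :
    matDeriv (fun u => (u ^ n)⁻¹ • w u) z =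
      (z ^ n)⁻¹ • (matDeriv w z - ((n : ℂ) * z⁻¹) • w z) := by
  ext i j
  have h := ((hasDerivAt_zpow (-(n : ℤ)) z (Or.inl hz)).mul
    (hw.entryDiffAt hz i j).hasDerivAt).deriv
  have e : (fun u => ((u ^ n)⁻¹ • w u) i j) = (fun u => u ^ (-(n : ℤ))) * fun u => w u i j := by
    funext u
    simp
  simp only [matDeriv, Matrix.of_apply, Matrix.smul_apply, Matrix.sub_apply, smul_eq_mul] at h ⊢
  simp only [Matrix.smul_apply, smul_eq_mul] at e
  rw [e, h, zpow_sub_one₀ hz, zpow_neg, zpow_natCast]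
  push_cast
  ring

theorem rightLogDeriv_weightMatrix (hw : IsAnalyticWeight w) (n : ℕ) {z : ℂ} (hz : z ≠ 0) :
    rightLogDeriv (weightMatrix w n) z =
      Matrix.fromBlocks (rightLogDeriv w z - ((n : ℂ) * z⁻¹) • 1) 0 0 0 := by
  have hu : w z * (w z)⁻¹ = 1 :=
    Matrix.mul_nonsing_inv _ ((Matrix.isUnit_iff_isUnit_det _).1 (hw.2 z hz))
  have hzn : z ^ n ≠ 0 := pow_ne_zero n hz
  have hinv : (weightMatrix w n z)⁻¹ = Matrix.fromBlocks (z ^ n • (w z)⁻¹) 0 0 1 := by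
    refine Matrix.inv_eq_right_inv ?_
    simp only [weightMatrix, Matrix.fromBlocks_multiply, smul_mul_assoc, Matrix.mul_smul, hu,
      smul_smul, inv_mul_cancel₀ hzn, one_smul, mul_zero, zero_mul, mul_one, add_zero, zero_add,
      Matrix.fromBlocks_one]
  have hder : matDeriv (weightMatrix w n) z =
      Matrix.fromBlocks (matDeriv (fun u => (u ^ n)⁻¹ • w u) z) 0 0 0 := by
    ext (i | i) (j | j)
    · rfl
    all_goals simp [matDeriv, weightMatrix]
  rw [rightLogDeriv, hinv, hder, matDeriv_inv_pow_smul hw n hz, Matrix.fromBlocks_multiply]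
  rw [Matrix.mul_smul, smul_mul_assoc, smul_smul, mul_inv_cancel₀ hzn, one_smul, sub_mul,
    smul_mul_assoc, hu, rightLogDeriv]
  simp only [mul_zero, zero_mul, add_zero]

theorem isUnit_unipotent :
    IsUnit (Matrix.fromBlocks 1 (-1) 0 1 : Matrix (Fin N ⊕ Fin N) (Fin N ⊕ Fin N) ℂ) := by
  simp [Matrix.isUnit_iff_isUnit_det]

/-- Off the unit circle, `Z_n` agrees up to a constant invertible right factor with a function
analytic and invertible on the punctured plane. -/
theorem exists_matZ_eventuallyEq (hw : IsAnalyticWeight w) (hq : QuasiDefinite w) (n : ℕ) {z : ℂ}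
    (hz1 : ‖z‖ ≠ 1) :
    ∃ J : Matrix (Fin N ⊕ Fin N) (Fin N ⊕ Fin N) ℂ, IsUnit J ∧
      ∀ᶠ u in nhds z, matZ w n u = rhMatrix w n u * (weightMatrix w n u * J) := by
  rcases lt_or_gt_of_ne hz1 with h | h
  · refine ⟨1, isUnit_one, ?_⟩
    filter_upwards [(isOpen_lt continuous_norm continuous_const).mem_nhds h] with u hu
    rw [matZ_inside hw n hu, mul_one]
  · refine ⟨_, isUnit_unipotent, ?_⟩
    filter_upwards [(isOpen_lt continuous_const continuous_norm).mem_nhds h] with u hu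
    exact matZ_outside hw hq n hu

theorem entryDiffAt_matZ (hw : IsAnalyticWeight w) (hq : QuasiDefinite w) (n : ℕ) {z : ℂ}
    (hz : z ≠ 0) (hz1 : ‖z‖ ≠ 1) : EntryDiffAt (matZ w n) z := by
  obtain ⟨J, -, h⟩ := exists_matZ_eventuallyEq hw hq n hz1
  exact ((entryDiffAt_rhMatrix hw n z).mul
    ((entryDiffAt_weightMatrix hw n hz).mul (entryDiffAt_const J z))).congr h

theorem isUnit_matZ (hw : IsAnalyticWeight w) (hq : QuasiDefinite w) (n : ℕ) {z : ℂ}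
    (hz : z ≠ 0) (hz1 : ‖z‖ ≠ 1) : IsUnit (matZ w n z) := by
  obtain ⟨J, hJ, h⟩ := exists_matZ_eventuallyEq hw hq n hz1
  rw [h.self_of_nhds]
  exact (isUnit_rhMatrix hw hq n z).mul ((isUnit_weightMatrix hw n hz).mul hJ)

theorem matM_eq (hw : IsAnalyticWeight w) (hq : QuasiDefinite w) (n : ℕ) {z : ℂ}
    (hz : z ≠ 0) (hz1 : ‖z‖ ≠ 1) :
    matM w n z = matDeriv (rhMatrix w n) z * (rhMatrix w n z)⁻¹ +
      rhMatrix w n z * Matrix.fromBlocks (rightLogDeriv w z - ((n : ℂ) * z⁻¹) • 1) 0 0 0 *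
        (rhMatrix w n z)⁻¹ := by
  obtain ⟨J, hJ, h⟩ := exists_matZ_eventuallyEq hw hq n hz1
  have hD := entryDiffAt_weightMatrix hw n hz
  rw [matM, rightLogDeriv_congr h, rightLogDeriv_mul (entryDiffAt_rhMatrix hw n z)
    (hD.mul (entryDiffAt_const J z)) ((isUnit_weightMatrix hw n hz).mul hJ),
    rightLogDeriv_mul_const hD hJ, rightLogDeriv_weightMatrix hw n hz]

end LogDeriv

/-! ### Laurent series -/

section Laurent

theorem hasSum_entry {ι κ α : Type*} {f : α → Matrix ι κ ℂ} {a : Matrix ι κ ℂ} (h : HasSum f a)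
    (i : ι) (j : κ) : HasSum (fun k => f k i j) (a i j) :=
  Pi.hasSum.1 (Pi.hasSum.1 h i) j

theorem injective_natCast_sub (p : ℕ) : Function.Injective fun k : ℕ => (k : ℤ) - p :=
  fun a b h => by simpa using h

theorem not_mem_range_natCast_sub {p : ℕ} {j : ℤ}
    (h : j ∉ Set.range fun k : ℕ => (k : ℤ) - p) : j < -(p : ℤ) := by
  by_contra hj
  exact h ⟨(j + p).toNat, by simp only; omega⟩

/-- A function with a pole of order at most `p` at the origin becomes entire
after multiplication by `z ^ p`. -/
theorem HasLaurentSeries.exists_entire {ι : Type*} {F : ℂ → Matrix ι ι ℂ}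
    {A : ℤ → Matrix ι ι ℂ} (hA : HasLaurentSeries F A) {p : ℕ}
    (hp : ∀ j : ℤ, j < -(p : ℤ) → A j = 0) :
    ∃ V : ℂ → Matrix ι ι ℂ, (∀ z, EntryDiffAt V z) ∧ V 0 = A (-p) ∧
      ∀ z, z ≠ 0 → V z = z ^ p • F z := by
  have hs : ∀ z : ℂ, z ≠ 0 → ∀ i j,
      HasSum (fun k : ℕ => z ^ k * A ((k : ℤ) - p) i j) (z ^ p * F z i j) := by
    intro z hz i j
    -- The series is supported on the indices `k - p` with `k : ℕ`, so it may be summed over `k`.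
    have h1 := (injective_natCast_sub p).hasSum_iff (f := fun j : ℤ => z ^ j • A j)
      (a := F z) (fun j hj => by rw [hp j (not_mem_range_natCast_sub hj), smul_zero])
    have h2 := (hasSum_entry (h1.2 (hA z hz)) i j).mul_left (z ^ p)
    have e : (fun k : ℕ => z ^ k * A ((k : ℤ) - p) i j) = fun k : ℕ =>
        z ^ p * ((fun j : ℤ => z ^ j • A j) ∘ fun k : ℕ => (k : ℤ) - p) k i j := by
      funext k
      simp only [Function.comp_apply, Matrix.smul_apply, smul_eq_mul]
      rw [← mul_assoc, ← zpow_natCast z p, ← zpow_add₀ hz, add_sub_cancel, zpow_natCast]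
    rw [e]
    exact h2
  refine ⟨fun z => Matrix.of fun i j => ∑' k : ℕ, z ^ k * A ((k : ℤ) - p) i j,
    fun z i j => differentiable_tsum (fun u hu => (hs u hu i j).summable) z, ?_, fun z hz => ?_⟩
  · ext i j
    have h : ∑' k : ℕ, (0 : ℂ) ^ k * A ((k : ℤ) - p) i j = _ :=
      tsum_eq_single 0 fun k hk => by simp [hk]
    simpa using h
  · ext i j
    exact (hs z hz i j).tsum_eq

/-- An entire matrix function divided by `z ^ p` has a Laurent series starting at `z ^ (-p)`. -/
theorem exists_hasLaurentSeries {ι : Type*} {K : ℂ → Matrix ι ι ℂ} (hK : ∀ z, EntryDiffAt K z)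
    (p : ℕ) :
    ∃ B : ℤ → Matrix ι ι ℂ, HasLaurentSeries (fun z => (z ^ p)⁻¹ • K z) B ∧
      (∀ j : ℤ, j < -(p : ℤ) → B j = 0) ∧ B (-p) = K 0 := by
  let T : ℕ → Matrix ι ι ℂ := fun k => Matrix.of fun i j =>
    (k.factorial : ℂ)⁻¹ * iteratedDeriv k (fun u => K u i j) 0
  have hT : ∀ z, HasSum (fun k : ℕ => z ^ k • T k) (K z) := by
    refine fun z => Pi.hasSum.2 fun i => Pi.hasSum.2 fun j => ?_
    have h := Complex.hasSum_taylorSeries_of_entire (fun u => hK u i j) 0 z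
    simp only [sub_zero, smul_eq_mul] at h
    have e : (fun k : ℕ => (z ^ k • T k) i j) = fun k : ℕ =>
        (k.factorial : ℂ)⁻¹ * (z ^ k * iteratedDeriv k (fun u => K u i j) 0) := by
      funext k
      simp only [T, Matrix.smul_apply, Matrix.of_apply, smul_eq_mul]
      ring
    rw [e]
    exact h
  let B : ℤ → Matrix ι ι ℂ := fun j => if j < -(p : ℤ) then 0 else T (j + p).toNat
  have hB : ∀ j : ℤ, j < -(p : ℤ) → B j = 0 := fun j hj => if_pos hj
  have hBT : ∀ k : ℕ, B ((k : ℤ) - p) = T k := by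
    intro k
    simp only [B]
    rw [if_neg (by omega)]
    congr 1
    omega
  refine ⟨B, fun z hz => ?_, hB, ?_⟩
  · refine ((injective_natCast_sub p).hasSum_iff fun j hj => ?_).1 ?_
    · rw [hB j (not_mem_range_natCast_sub hj), smul_zero]
    · have e : ((fun j : ℤ => z ^ j • B j) ∘ fun k : ℕ => (k : ℤ) - p) = fun k : ℕ =>
          (z ^ p)⁻¹ • z ^ k • T k := by
        funext k
        simp only [Function.comp_apply, hBT]
        rw [smul_smul, zpow_sub₀ hz, zpow_natCast, zpow_natCast, div_eq_mul_inv, mul_comm]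
      rw [e]
      exact (hT z).const_smul _
  · have h0 := hBT 0
    rw [Nat.cast_zero, zero_sub] at h0
    rw [h0]
    ext i j
    simp [T]

end Laurent

/-! ### The leading coefficient -/

section Leading

variable {N : ℕ} {w : ℂ → Mat N}

theorem OriginType.one_le_order {A : ℤ → Mat N} {t : OriginType} (ht : t.Describes A) :
    1 ≤ t.order := by
  cases t with
  | ordinary => exact le_rfl
  | fuchsian => exact le_rfl
  | nonFuchsian r => exact ht.1.le

theorem OriginType.coeff_eq_zero {A : ℤ → Mat N} {t : OriginType} (ht : t.Describes A) (j : ℤ)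
    (hj : j < -(t.order : ℤ)) : A j = 0 := by
  cases t with
  | ordinary => exact ht j (hj.trans_le (by simp [OriginType.order]))
  | fuchsian => exact ht.2 j (by simpa [OriginType.order] using hj)
  | nonFuchsian r => exact ht.2.2 j hj

/-- The left side is the value at the origin of `z ^ p (W - n/z)`. As `0 ^ 0 = 1`, the term with `n`
survives exactly for `p = 1`; in the ordinary case moreover `A (-1) = 0`. -/
theorem OriginType.leading_eq {A : ℤ → Mat N} {t : OriginType} (ht : t.Describes A) (n : ℕ) :
    A (-(t.order : ℤ)) - ((n : ℂ) * 0 ^ (t.order - 1)) • (1 : Mat N) = t.leading A n := by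
  cases t with
  | ordinary =>
    have h : A (-1) = 0 := ht (-1) (by norm_num)
    simp [OriginType.order, OriginType.leading, h]
  | fuchsian => simp [OriginType.order, OriginType.leading]
  | nonFuchsian r =>
    have h : r - 1 ≠ 0 := by have := ht.1; omega
    simp [OriginType.order, OriginType.leading, h]

/-- Since `diag(W, 0)` factors through the first block, only the first block column of `X` and the
first block row of `X⁻¹` matter. The hypothesis `hcd` identifies that row without inverting `X`. -/
theorem mul_fromBlocks_mul_inv {X : Matrix (Fin N ⊕ Fin N) (Fin N ⊕ Fin N) ℂ} (hX : IsUnit X)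
    {a b c d x y : Mat N} (hab : X = Matrix.fromBlocks a x b y)
    (hcd : Matrix.fromCols c d * X = (Matrix.fromCols 1 0 : Matrix (Fin N) (Fin N ⊕ Fin N) ℂ))
    (W : Mat N) :
    X * Matrix.fromBlocks W 0 0 0 * X⁻¹ =
      Matrix.fromRows a b * W * Matrix.fromCols c d := by
  have h1 : Matrix.fromBlocks W 0 0 0 =
      (Matrix.fromRows 1 0 : Matrix (Fin N ⊕ Fin N) (Fin N) ℂ) * W *
        (Matrix.fromCols 1 0 : Matrix (Fin N) (Fin N ⊕ Fin N) ℂ) := by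
    rw [Matrix.fromRows_mul, Matrix.fromRows_mul_fromCols]
    simp
  have h2 : X * (Matrix.fromRows 1 0 : Matrix (Fin N ⊕ Fin N) (Fin N) ℂ) =
      Matrix.fromRows a b := by
    rw [hab, Matrix.fromBlocks_mul_fromRows]
    simp
  have h3 : Matrix.fromCols c d =
      (Matrix.fromCols 1 0 : Matrix (Fin N) (Fin N ⊕ Fin N) ℂ) * X⁻¹ := by
    rw [← hcd, Matrix.mul_nonsing_inv_cancel_right _ _ ((Matrix.isUnit_iff_isUnit_det _).1 hX)]
  rw [h1, h3, ← h2]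
  simp only [Matrix.mul_assoc]

theorem fromRows_mul_mul_fromCols (a b c d W : Mat N) :
    Matrix.fromRows a b * W * Matrix.fromCols c d =
      Matrix.fromBlocks (a * W * c) (a * W * d) (b * W * c) (b * W * d) := by
  rw [Matrix.fromRows_mul, Matrix.fromRows_mul_fromCols]

theorem rhMatrix_conj_zero (hw : IsAnalyticWeight w) (hq : QuasiDefinite w) (W : Mat N) :
    rhMatrix w 0 0 * Matrix.fromBlocks W 0 0 0 * (rhMatrix w 0 0)⁻¹ =
      Matrix.fromBlocks W (-(W * quasiTauR w 0)) 0 0 := by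
  have h : weightedRegular w 0 (evalAt (szegoL1 w 0)) 0 = quasiTauR w 0 := by
    rw [weightedRegular_zero hw _ (entryDiffAt_evalAt _), quasiTauR_eq_convCoeff hw hq,
      ← circleMean_reciprocal hw]
    simp only [evalAt_szegoL1_zero hw hq, reciprocalAt_szegoR2_zero hw hq]
  rw [mul_fromBlocks_mul_inv (isUnit_rhMatrix hw hq 0 0) (c := 1) (d := -quasiTauR w 0)
    rfl ?_, fromRows_mul_mul_fromCols]
  · simp
  · rw [rhMatrix, h, Matrix.fromCols_mul_fromBlocks]
    simp

theorem rhMatrix_conj_succ (hw : IsAnalyticWeight w) (hq : QuasiDefinite w) (n : ℕ) (W : Mat N) :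
    rhMatrix w (n + 1) 0 * Matrix.fromBlocks W 0 0 0 * (rhMatrix w (n + 1) 0)⁻¹ =
      Matrix.fromRows (verblunskyL1 w (n + 1)) (-(quasiTauR w n)⁻¹) * W *
        Matrix.fromCols (verblunskyR2 w (n + 1))ᴴ (-quasiTauR w (n + 1)) := by
  have hone : ∀ n, reciprocalAt n (szegoR2 w n) 0 = 1 := fun n => by
    rw [reciprocalAt_eq_sum, Finset.sum_range_succ']
    simp [recipCoeff_zero hw hq]
  have hX : rhMatrix w (n + 1) 0 = Matrix.fromBlocks (verblunskyL1 w (n + 1))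
      (weightedRegular w (n + 1) (evalAt (szegoL1 w (n + 1))) 0) (-(quasiTauR w n)⁻¹)
      (-(quasiTauR w n)⁻¹ * weightedRegular w (n + 1) (reciprocalAt n (szegoR2 w n)) 0) := by
    rw [rhMatrix, szegoMatrix, hone, Matrix.fromBlocks_multiply, verblunskyL1]
    simp
  refine mul_fromBlocks_mul_inv (isUnit_rhMatrix hw hq (n + 1) 0) hX ?_ W
  have h1 := reciprocal_succ hw hq n 0
  -- At the origin the left side is the coefficient of index `n + 1` of `P̃^R_{2,n+1} w`, which is
  -- zero. This is the second block of the row identity, and `h1` is the first.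
  have h2 := weightedRegular_reciprocal_succ hw hq n (n + 1) 0
  rw [hone, hone, mul_one] at h1
  rw [weightedRegular_zero hw _ (entryDiffAt_reciprocalAt (n + 1) _), circleMean_reciprocal hw,
    convCoeff_recipCoeff hw hq (by omega) le_rfl] at h2
  rw [hX, Matrix.fromCols_mul_fromBlocks, neg_mul_neg, ← Matrix.mul_assoc, neg_mul_neg, ← h2]
  rw [verblunskyL1, ← h1]

end Leading

end MatrixSzego

/-! ### Proof of the main theorem -/

theorem mainTheorem4 {N : ℕ} (w : ℂ → Mat N) (hw : IsAnalyticWeight w) (hq : QuasiDefinite w)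
    (A : ℤ → Mat N) (hA : HasLaurentSeries (rightLogDeriv w) A)
    (t : OriginType) (ht : t.Describes A) (n : ℕ) :
    -- the objects in the claim are well defined
    (∀ k, IsUnit (quasiTauR w k)) ∧
    (∀ z : ℂ, z ≠ 0 → ‖z‖ ≠ 1 →
      (∀ i j, DifferentiableAt ℂ (fun u => matZ w n u i j) z) ∧ IsUnit (matZ w n z)) ∧
    -- the Laurent series and its leading coefficient
    ∃ (F : ℂ → Matrix (Fin N ⊕ Fin N) (Fin N ⊕ Fin N) ℂ)
      (B : ℤ → Matrix (Fin N ⊕ Fin N) (Fin N ⊕ Fin N) ℂ),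
      (∀ z : ℂ, z ≠ 0 → ‖z‖ ≠ 1 → F z = matM w n z) ∧
      HasLaurentSeries F B ∧
      (∀ j : ℤ, j < -(t.order : ℤ) → B j = 0) ∧
      (n = 0 →
        B (-(t.order : ℤ)) =
          Matrix.fromBlocks (t.leading A 0) (-(t.leading A 0 * quasiTauR w 0)) 0 0) ∧
      (1 ≤ n →
        B (-(t.order : ℤ)) =
          Matrix.fromBlocks
            (verblunskyL1 w n * t.leading A n * (verblunskyR2 w n)ᴴ)
            (-(verblunskyL1 w n * t.leading A n * quasiTauR w n))
            (-((quasiTauR w (n - 1))⁻¹ * t.leading A n * (verblunskyR2 w n)ᴴ))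
            ((quasiTauR w (n - 1))⁻¹ * t.leading A n * quasiTauR w n) ∧
        B (-(t.order : ℤ)) =
          Matrix.fromRows (verblunskyL1 w n) (-(quasiTauR w (n - 1))⁻¹) * t.leading A n *
            Matrix.fromCols (verblunskyR2 w n)ᴴ (-quasiTauR w n)) := by
  have hp := OriginType.one_le_order ht
  obtain ⟨V, hV, hV0, hVz⟩ := hA.exists_entire (OriginType.coeff_eq_zero ht)
  set p := t.order with hpdef
  -- The entire extension of `z ^ p • M_n(z)`, with `V` in place of `z ^ p • W(z)`. As `p ≥ 1`, the
  -- summand with the derivative of `rhMatrix` vanishes at the origin.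
  let K : ℂ → Matrix (Fin N ⊕ Fin N) (Fin N ⊕ Fin N) ℂ := fun z =>
    z ^ p • (matDeriv (rhMatrix w n) z * (rhMatrix w n z)⁻¹) +
      rhMatrix w n z * Matrix.fromBlocks (V z - ((n : ℂ) * z ^ (p - 1)) • (1 : Mat N)) 0 0 0 *
        (rhMatrix w n z)⁻¹
  have hX := entryDiffAt_rhMatrix hw n
  have hXinv : ∀ z, EntryDiffAt (fun u => (rhMatrix w n u)⁻¹) z := fun z =>
    (hX z).inv (isUnit_rhMatrix hw hq n z)
  have hK : ∀ z, EntryDiffAt K z := by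
    intro z
    refine EntryDiffAt.add (EntryDiffAt.smul (differentiableAt_pow p) (EntryDiffAt.mul
      (entryDiffAt_matDeriv isOpen_univ (fun u _ => hX u) (Set.mem_univ z)) (hXinv z)))
      (((hX z).mul (EntryDiffAt.fromBlocks ((hV z).sub (EntryDiffAt.smul
        ((differentiableAt_pow (p - 1)).const_mul _) (entryDiffAt_const 1 z)))
        (entryDiffAt_const 0 z) (entryDiffAt_const 0 z) (entryDiffAt_const 0 z))).mul (hXinv z))
  have hKM : ∀ z, z ≠ 0 → ‖z‖ ≠ 1 → (z ^ p)⁻¹ • K z = matM w n z := by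
    intro z hz hz1
    have e : Matrix.fromBlocks (V z - ((n : ℂ) * z ^ (p - 1)) • (1 : Mat N)) 0 0 (0 : Mat N) =
        z ^ p • Matrix.fromBlocks (rightLogDeriv w z - ((n : ℂ) * z⁻¹) • 1) 0 0 0 := by
      rw [Matrix.fromBlocks_smul, smul_zero, smul_sub, hVz z hz, smul_smul, pow_sub₀ z hz hp]
      congr 3
      ring
    have hzp : z ^ p ≠ 0 := pow_ne_zero p hz
    simp only [K]
    rw [e, Matrix.mul_smul, smul_mul_assoc, ← smul_add, smul_smul, inv_mul_cancel₀ hzp, one_smul,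
      matM_eq hw hq n hz hz1]
  have hK0 : K 0 = rhMatrix w n 0 * Matrix.fromBlocks (t.leading A n) 0 0 0 *
      (rhMatrix w n 0)⁻¹ := by
    simp only [K]
    rw [zero_pow (by omega), zero_smul, zero_add, hV0, hpdef, OriginType.leading_eq ht]
  obtain ⟨B, hB, hBlt, hBp⟩ := exists_hasLaurentSeries hK p
  refine ⟨isUnit_quasiTauR hw hq,
    fun z hz hz1 => ⟨entryDiffAt_matZ hw hq n hz hz1, isUnit_matZ hw hq n hz hz1⟩,
    _, B, hKM, hB, hBlt, ?_, ?_⟩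
  · rintro rfl
    rw [hBp, hK0, rhMatrix_conj_zero hw hq]
  · intro hn
    obtain ⟨m, rfl⟩ := Nat.exists_eq_add_of_le' hn
    rw [hBp, hK0, rhMatrix_conj_succ hw hq, Nat.add_sub_cancel]
    refine ⟨?_, rfl⟩
    rw [fromRows_mul_mul_fromCols]
    simp only [mul_neg, neg_mul, neg_neg]
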